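/- Let $\|\cdot\|$ be the operator norm on $\mathbf{M}_d(\mathbb{C})$, $d\ge 1$, induced by the Euclidean norm, and let $\ell\ge 1$. Let $\Sigma_\ell=\{1,\dots,\ell\}^{\mathbb{N}}$ carry the product topology and the shift $\sigma$, and let $[i]\subset\Sigma_\ell$ be the set of sequences with first entry $i$. For a family $\mathsf{A}=\{A_1,\dots,A_\ell\}\subset\mathbf{M}_d(\mathbb{C})$ (repetitions allowed), $x\in\Sigma_\ell$ and $n\ge1$ put $\mathcal{L}_{\mathsf{A}}(x,n)=A_{x_n}\cdots A_{x_1}$ and $\varrho(\mathsf{A})=\lim_{n\to\infty}\sup_{x\in\Sigma_\ell}\|\mathcal{L}_{\mathsf{A}}(x,n)\|^{1/n}$ (the joint spectral radius). A sequence $x\in\Sigma_\ell$ is *weakly extremal* if $\|\mathcal{L}_{\mathsf{A}}(x,n)\|^{1/n}\to\varrho(\mathsf{A})$, and *strongly extremal* if there is $\varepsilon>0$ with $\|\mathcal{L}_{\mathsf{A}}(x,n)\|\ge\varepsilon\varrho(\mathsf{A})^n$ for all $n\ge1$. A *Barabanov norm* for $\mathsf{A}$ is a norm $|\!|\!|\cdot|\!|\!|$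 on $\mathbb{C}^d$ with $\varrho(\mathsf{A})|\!|\!|v|\!|\!|=\max_k|\!|\!|A_kv|\!|\!|$ for all $v$; $x$ is *Kozyakin extremal* if there are a Barabanov norm $|\!|\!|\cdot|\!|\!|$ for $\mathsf{A}$ and $v$ with $|\!|\!|v|\!|\!|=1$ such that $|\!|\!|\mathcal{L}_{\mathsf{A}}(x,n)v|\!|\!|=\varrho(\mathsf{A})^n$ for all $n\ge1$. A *maximising measure* of $\mathsf{A}$ is a $\sigma$-invariant Borel probability measure $\mu$ on $\Sigma_\ell$ with $\inf_{n\ge1}\frac1n\int\log\|\mathcal{L}_{\mathsf{A}}(x,n)\|\,d\mu(x)=\log\varrho(\mathsf{A})$, where $\log 0=-\infty$. For $1\le i\le\ell$, a number $\gamma\in[0,1]$ is an *optimal $i$-ratio* of $\mathsf{A}$ if at least one of the following holds: (i) $\frac1n\#\{1\le j\le n: x_j=i\}\to\gamma$ for every weakly extremal $x$; (ii) the same for every strongly extremal $x$; (iii) $\mu([i])=\gamma$ for every ergodic maximising measure $\mu$ of $\mathsf{A}$; (iv) $\mu([i])=\gamma$ for every maximising measure $\mu$ of $\mathsf{A}$;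 (v) a Barabanov norm for $\mathsf{A}$ exists and $\frac1n\#\{1\le j\le n: x_j=i\}\to\gamma$ for every Kozyakin extremal $x$. We say that $\mathsf{A}$ *has a unique optimal $i$-ratio* if such a $\gamma$ exists. **Theorem.** Let $\Delta$ be a metric space, let $A_1,\dots,A_\ell\colon\Delta\to\mathbf{M}_d(\mathbb{C})$ be continuous, and let $1\le i\le\ell$. Suppose that for each $\lambda\in\Delta$ the family $\mathsf{A}_\lambda=\{A_1(\lambda),\dots,A_\ell(\lambda)\}$ has a unique optimal $i$-ratio. Then for each $\lambda$ there is exactly one optimal $i$-ratio $\mathfrak{r}(\lambda)\in[0,1]$ of $\mathsf{A}_\lambda$, and the function $\mathfrak{r}\colon\Delta\to[0,1]$ is continuous. -/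

import Mathlib

open Filter Topology MeasureTheory
open scoped Matrix Matrix.Norms.L2Operator

/- Here `‖M‖` for a square complex matrix `M` is the operator norm induced by the Euclidean norm.
A finite matrix set `{A₁, …, A_ℓ}` is given by its indexed family `A : Fin ℓ → Matrix _ _ ℂ`
(not assumed injective); index sequences are `x : ℕ → Fin ℓ`, with entries numbered from `0`. -/

namespace OptimalRatio

noncomputable section

/-- The shift on index sequences. -/
def shift {ℓ : ℕ} (x : ℕ → Fin ℓ) : ℕ → Fin ℓ := fun n => x (n + 1)

/-- The set of all sequences whose first entry is `i`. -/
def cylinder {ℓ : ℕ} (i : Fin ℓ) : Set (ℕ → Fin ℓ) := {x | x 0 = i}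

variable {d ℓ : ℕ}

/-- The product `A (x (n-1)) * ⋯ * A (x 1) * A (x 0)` of the first `n` matrices along `x`. -/
def partialProd (A : Fin ℓ → Matrix (Fin d) (Fin d) ℂ) (x : ℕ → Fin ℓ) :
    ℕ → Matrix (Fin d) (Fin d) ℂ
  | 0 => 1
  | n + 1 => A (x n) * partialProd A x n

/-- The joint spectral radius, `lim_n sup_x ‖L(x,n)‖^(1/n)`.  The limit exists (Fekete), and is
written as an upper limit of a bounded sequence. -/
def jointSpectralRadius (A : Fin ℓ → Matrix (Fin d) (Fin d) ℂ) : ℝ :=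
  limsup (fun n : ℕ => ⨆ x : ℕ → Fin ℓ, ‖partialProd A x n‖ ^ (n : ℝ)⁻¹) atTop

/-- The logarithm on the nonnegative reals, with the convention `log 0 = -∞`. -/
def extLog (t : ℝ) : EReal := ENNReal.log (ENNReal.ofReal t)

/-- The integral of an extended-real function, as the integral of its positive part minus the
integral of its negative part (only used for functions bounded above, on finite measures). -/
def extIntegral {X : Type*} [MeasurableSpace X] (μ : Measure X) (f : X → EReal) : EReal :=
  ((∫⁻ x, (f x).toENNReal ∂μ : ENNReal) : EReal) -
    ((∫⁻ x, (-f x).toENNReal ∂μ : ENNReal) : EReal)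

/-- `μ` is a maximising measure of `A`: a shift-invariant Borel probability measure with
`inf_{n ≥ 1} (1/n) ∫ log ‖L(x,n)‖ dμ(x) = log ϱ(A)`. -/
def IsMaximising (A : Fin ℓ → Matrix (Fin d) (Fin d) ℂ) (μ : Measure (ℕ → Fin ℓ)) : Prop :=
  IsProbabilityMeasure μ ∧ MeasurePreserving shift μ μ ∧
    (⨅ n : ℕ, ⨅ _ : 1 ≤ n,
      (((n : ℝ)⁻¹ : ℝ) : EReal) * extIntegral μ (fun x => extLog ‖partialProd A x n‖)) =
      extLog (jointSpectralRadius A)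

/-- `‖L(x,n)‖^(1/n)` converges to `ϱ(A)`. -/
def WeaklyExtremal (A : Fin ℓ → Matrix (Fin d) (Fin d) ℂ) (x : ℕ → Fin ℓ) : Prop :=
  Tendsto (fun n : ℕ => ‖partialProd A x n‖ ^ (n : ℝ)⁻¹) atTop (𝓝 (jointSpectralRadius A))

/-- There is `ε > 0` with `‖L(x,n)‖ ≥ ε ϱ(A)^n` for all `n ≥ 1`. -/
def StronglyExtremal (A : Fin ℓ → Matrix (Fin d) (Fin d) ℂ) (x : ℕ → Fin ℓ) : Prop :=
  ∃ ε : ℝ, 0 < ε ∧ ∀ n : ℕ, 1 ≤ n → ε * jointSpectralRadius A ^ n ≤ ‖partialProd A x n‖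

/-- `p` is a norm on `ℂ^d` with `ϱ(A) p(v) = max_k p(A_k v)` for all `v`. -/
def IsBarabanovNorm (A : Fin ℓ → Matrix (Fin d) (Fin d) ℂ) (p : Seminorm ℂ (Fin d → ℂ)) : Prop :=
  (∀ v, p v = 0 → v = 0) ∧
    ∀ v, IsGreatest (Set.range fun k => p (A k *ᵥ v)) (jointSpectralRadius A * p v)

/-- For some Barabanov norm `p` and some `v` with `p v = 1`, `p (L(x,n) v) = ϱ(A)^n` for all
`n ≥ 1`. -/
def KozyakinExtremal (A : Fin ℓ → Matrix (Fin d) (Fin d) ℂ) (x : ℕ → Fin ℓ) : Prop :=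
  ∃ p : Seminorm ℂ (Fin d → ℂ), IsBarabanovNorm A p ∧ ∃ v : Fin d → ℂ, p v = 1 ∧
    ∀ n : ℕ, 1 ≤ n → p (partialProd A x n *ᵥ v) = jointSpectralRadius A ^ n

/-- The symbol `i` has asymptotic frequency `γ` in `x`:
`(1/n) ∑_{k<n} χ_[i](σ^k x) → γ`. -/
def HasFrequency (i : Fin ℓ) (x : ℕ → Fin ℓ) (γ : ℝ) : Prop :=
  Tendsto (fun n : ℕ => birkhoffAverage ℝ shift ((cylinder i).indicator fun _ => (1 : ℝ)) n x)
    atTop (𝓝 γ)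

/-- `γ ∈ [0,1]` is an optimal `i`-ratio of `A`: one of the alternative conditions (on weakly
extremal sequences, strongly extremal sequences, ergodic maximising measures, all maximising
measures, or, if a Barabanov norm exists, Kozyakin extremal sequences) holds for `γ`. -/
def IsOptimalRatio (A : Fin ℓ → Matrix (Fin d) (Fin d) ℂ) (i : Fin ℓ) (γ : ℝ) : Prop :=
  γ ∈ Set.Icc (0 : ℝ) 1 ∧
    ((∀ x, WeaklyExtremal A x → HasFrequency i x γ) ∨
     (∀ x, StronglyExtremal A x → HasFrequency i x γ) ∨
     (∀ μ : Measure (ℕ → Fin ℓ), IsMaximising A μ → Ergodic shift μ →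
        μ.real (cylinder i) = γ) ∨
     (∀ μ : Measure (ℕ → Fin ℓ), IsMaximising A μ → μ.real (cylinder i) = γ) ∨
     ((∃ p, IsBarabanovNorm A p) ∧ ∀ x, KozyakinExtremal A x → HasFrequency i x γ))

/-- `A` has a unique optimal `i`-ratio. -/
def HasUniqueOptimalRatio (A : Fin ℓ → Matrix (Fin d) (Fin d) ℂ) (i : Fin ℓ) : Prop :=
  ∃ γ : ℝ, IsOptimalRatio A i γ

end

end OptimalRatio

/-! Everything passes through maximising measures. Each of the five conditions forces `μ.real
(cylinder i) = γ` for every maximising measure `μ` (`IsOptimalRatio.measureReal_eq`). Maximising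
measures exist (`exists_isMaximising`), so the ratio is unique. Limits of maximising measures of
`A_a` as `a → a₀` are maximising for `A_{a₀}` (`isMaximising_of_tendsto`), and the space of
probability measures on the shift is compact. As the cylinder is clopen, the ratio is therefore
continuous.

The limit statement needs lower semicontinuity of the joint spectral radius,
`eventually_le_growthRate`. It comes from a Berger-Wang type theorem, `exists_eigenvalue_of_lt`: the
growth rate is approximated by eigenvalues of finite products, and those move continuously with the
parameter.

The five conditions are handled as follows. Strongly extremal sequences are weakly extremal, so (i)
implies (ii). For (iii), maximise or minimise `μ([i])` over maximising measures; an extreme point of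
the optimal face is ergodic. For (v), under an extremal norm almost every point of a maximising
measure has a vector whose orbit grows exactly like `ϱ ^ n`; any Barabanov norm is such a norm.

For (ii), if the products are `O(ϱ ^ n)` then almost every point of a maximising measure is strongly
extremal. Otherwise there is a common invariant subspace, the family is block triangular, and
induction on the dimension applies. A maximising measure of the family need not obviously maximise
either block, so the matrix of index `i` is scaled by `exp t`. The growth rate then has `μ([i])` as
a subgradient in `t` on the logarithmic scale, and it is the maximum of the rates of the two blocks.
Letting `t → 0` from either side gives a maximising measure of one block whose `[i]`-mass is at
least, respectively at most, `μ([i])`.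

Logarithms are truncated from below throughout, so that integrands are continuous and weak
convergence applies. Subadditivity and integration take the place of ergodic theorems. -/

namespace OptimalRatio

noncomputable section

/-! ### Products along sequences -/

section Products

variable {ℓ : ℕ} {M : Type*} [Monoid M]

/-- The product `T (x (n-1)) * ⋯ * T (x 0)` in a monoid. -/
def prodAlong (T : Fin ℓ → M) (x : ℕ → Fin ℓ) : ℕ → M
  | 0 => 1
  | n + 1 => T (x n) * prodAlong T x n

@[simp] lemma prodAlong_zero (T : Fin ℓ → M) (x : ℕ → Fin ℓ) : prodAlong T x 0 = 1 := rfl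

lemma prodAlong_succ (T : Fin ℓ → M) (x : ℕ → Fin ℓ) (n : ℕ) :
    prodAlong T x (n + 1) = T (x n) * prodAlong T x n := rfl

lemma shift_iterate_apply (x : ℕ → Fin ℓ) (m n : ℕ) : (shift^[m] x) n = x (m + n) := by
  induction m generalizing x with
  | zero => simp
  | succ m ih =>
    rw [Function.iterate_succ_apply, ih]
    simp only [shift]
    congr 1
    omega

lemma prodAlong_add (T : Fin ℓ → M) (x : ℕ → Fin ℓ) (m n : ℕ) :
    prodAlong T x (m + n) = prodAlong T (shift^[m] x) n * prodAlong T x m := by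
  induction n with
  | zero => simp
  | succ n ih =>
    rw [← add_assoc, prodAlong_succ, prodAlong_succ, ih, shift_iterate_apply, mul_assoc]

lemma prodAlong_one (T : Fin ℓ → M) (x : ℕ → Fin ℓ) : prodAlong T x 1 = T (x 0) := by
  simp [prodAlong_succ]

lemma prodAlong_succ' (T : Fin ℓ → M) (x : ℕ → Fin ℓ) (n : ℕ) :
    prodAlong T x (n + 1) = prodAlong T (shift x) n * T (x 0) := by
  rw [add_comm, prodAlong_add, prodAlong_one, Function.iterate_one]

/-- Prepend a letter to a sequence. -/
def cons (k : Fin ℓ) (x : ℕ → Fin ℓ) : ℕ → Fin ℓ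
  | 0 => k
  | n + 1 => x n

lemma prodAlong_cons (T : Fin ℓ → M) (k : Fin ℓ) (x : ℕ → Fin ℓ) (n : ℕ) :
    prodAlong T (cons k x) (n + 1) = prodAlong T x n * T k := prodAlong_succ' ..

lemma prodAlong_congr (T : Fin ℓ → M) {x y : ℕ → Fin ℓ} {n : ℕ} (h : ∀ j < n, x j = y j) :
    prodAlong T x n = prodAlong T y n := by
  induction n with
  | zero => rfl
  | succ n ih =>
    rw [prodAlong_succ, prodAlong_succ, h n (by omega), ih fun j hj => h j (by omega)]

lemma map_prodAlong {M' F : Type*} [Monoid M'] [FunLike F M M'] [MonoidHomClass F M M']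
    (f : F) (T : Fin ℓ → M) (x : ℕ → Fin ℓ) (n : ℕ) :
    f (prodAlong T x n) = prodAlong (fun k => f (T k)) x n := by
  induction n with
  | zero => simp
  | succ n ih => simp [prodAlong_succ, ih]

lemma exists_prodAlong_eq_pow (T : Fin ℓ → M) (x : ℕ → Fin ℓ) (n : ℕ) :
    ∃ y, ∀ q, prodAlong T y (q * n) = prodAlong T x n ^ q := by
  refine ⟨fun j => x (j % n), fun q => ?_⟩
  induction q with
  | zero => simp
  | succ q ih =>
    rw [Nat.succ_mul, prodAlong_add, ih, pow_succ']
    congr 1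
    refine prodAlong_congr T fun j hj => ?_
    rw [shift_iterate_apply, Nat.mul_add_mod_self_right, Nat.mod_eq_of_lt hj]

lemma continuous_prodAlong {Δ : Type*} [TopologicalSpace Δ] [TopologicalSpace M] [ContinuousMul M]
    {T : Fin ℓ → Δ → M} (hT : ∀ k, Continuous (T k)) (n : ℕ) :
    Continuous fun p : Δ × (ℕ → Fin ℓ) => prodAlong (fun k => T k p.1) p.2 n := by
  induction n with
  | zero => exact continuous_const
  | succ n ih =>
    have h1 : Continuous fun q : Fin ℓ × Δ => T q.1 q.2 :=
      continuous_prod_of_discrete_left.2 hT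
    exact (h1.comp (f := fun p : Δ × (ℕ → Fin ℓ) => (p.2 n, p.1)) (by fun_prop)).mul ih

lemma continuous_prodAlong_right [TopologicalSpace M] [ContinuousMul M]
    (T : Fin ℓ → M) (n : ℕ) : Continuous fun x => prodAlong T x n :=
  (continuous_prodAlong (Δ := Unit) (T := fun k _ => T k) (fun _ => continuous_const) n).comp
    (f := fun x => ((), x)) (by fun_prop)

end Products

lemma partialProd_eq_prodAlong {d ℓ : ℕ} (A : Fin ℓ → Matrix (Fin d) (Fin d) ℂ)
    (x : ℕ → Fin ℓ) (n : ℕ) : partialProd A x n = prodAlong A x n := by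
  induction n with
  | zero => rfl
  | succ n ih => rw [partialProd, prodAlong_succ, ih]

lemma continuous_shift {ℓ : ℕ} : Continuous (shift : (ℕ → Fin ℓ) → ℕ → Fin ℓ) :=
  continuous_pi fun n => continuous_apply (n + 1)

lemma continuous_shift_iterate {ℓ : ℕ} (m : ℕ) :
    Continuous (shift^[m] : (ℕ → Fin ℓ) → ℕ → Fin ℓ) := continuous_shift.iterate m

/-! ### Submultiplicative cocycles and their growth rates -/

/-- A submultiplicative family of continuous nonnegative functions over the shift. -/
structure IsCocycle {ℓ : ℕ} (N : ℕ → (ℕ → Fin ℓ) → ℝ) : Prop where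
  nonneg : ∀ n x, 0 ≤ N n x
  cont : ∀ n, Continuous (N n)
  le_mul : ∀ m n x, N (m + n) x ≤ N n (shift^[m] x) * N m x

/-- `R` is the exponential growth rate of `sup_x N n x`. -/
structure IsGrowthRate {ℓ : ℕ} (N : ℕ → (ℕ → Fin ℓ) → ℝ) (R : ℝ) : Prop where
  nonneg : 0 ≤ R
  exists_le : ∀ n, 1 ≤ n → ∃ x, R ^ n ≤ N n x
  le : ∀ S, R < S → ∃ C, 0 < C ∧ ∀ n x, N n x ≤ C * S ^ n

section Growth

variable {ℓ : ℕ} {N : ℕ → (ℕ → Fin ℓ) → ℝ}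

lemma le_of_forall_pow_le_mul {a b C : ℝ} (hb : 0 < b)
    (h : ∀ n : ℕ, 1 ≤ n → a ^ n ≤ C * b ^ n) : a ≤ b := by
  by_contra! hab
  have h1 : 1 < a / b := (one_lt_div hb).2 hab
  obtain ⟨n, hn⟩ := pow_unbounded_of_one_lt C h1
  have h2 : C < (a / b) ^ (n + 1) := hn.trans_le (pow_le_pow_right₀ h1.le (by omega))
  rw [div_pow, lt_div_iff₀ (by positivity)] at h2
  exact absurd (h (n + 1) (by omega)) (not_le.2 h2)

lemma IsGrowthRate.le_of_forall_le {R S C : ℝ} (hR : IsGrowthRate N R) (hS : 0 < S)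
    (h : ∀ n x, N n x ≤ C * S ^ n) : R ≤ S :=
  le_of_forall_pow_le_mul hS fun n hn => by
    obtain ⟨x, hx⟩ := hR.exists_le n hn
    exact hx.trans (h n x)

lemma IsGrowthRate.le_of_le {N' : ℕ → (ℕ → Fin ℓ) → ℝ} {R R' K : ℝ} (hR : IsGrowthRate N R)
    (hR' : IsGrowthRate N' R') (hK : 0 ≤ K) (h : ∀ n x, N n x ≤ K * N' n x) : R ≤ R' := by
  refine le_of_forall_gt_imp_ge_of_dense fun S hS => ?_
  obtain ⟨C, -, hC⟩ := hR'.le S hS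
  refine hR.le_of_forall_le (C := K * C) (hR'.nonneg.trans_lt hS) fun n x => ?_
  calc N n x ≤ K * N' n x := h n x
    _ ≤ K * (C * S ^ n) := by gcongr; exact hC n x
    _ = _ := by ring

lemma IsGrowthRate.unique {R R' : ℝ} (hR : IsGrowthRate N R) (hR' : IsGrowthRate N R') :
    R = R' :=
  le_antisymm (hR.le_of_le hR' zero_le_one (by simp)) (hR'.le_of_le hR zero_le_one (by simp))

lemma IsCocycle.exists_bound (hN : IsCocycle N) (m : ℕ) :
    ∃ K, 1 ≤ K ∧ ∀ n ≤ m, ∀ x, N n x ≤ K := by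
  have h : ∀ n, ∃ K, ∀ x, N n x ≤ K := fun n => by
    obtain ⟨K, hK⟩ := isCompact_univ.bddAbove_image (hN.cont n).continuousOn
    exact ⟨K, fun x => hK ⟨x, trivial, rfl⟩⟩
  choose K hK using h
  refine ⟨1 + ∑ n ∈ Finset.range (m + 1), |K n|, ?_, fun n hn x => ?_⟩
  · have : 0 ≤ ∑ n ∈ Finset.range (m + 1), |K n| := Finset.sum_nonneg fun _ _ => abs_nonneg _
    linarith
  · have := Finset.single_le_sum (f := fun n => |K n|) (fun _ _ => abs_nonneg _)
      (Finset.mem_range.2 (Nat.lt_succ_of_le hn))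
    have h2 := hK n x
    have h3 := le_abs_self (K n)
    linarith

/-- Fekete's argument: a bound at a single time `n` propagates to all multiples of `n` by
submultiplicativity, and remainders below `n` cost only a constant. -/
lemma IsCocycle.le_of_lt_at (hN : IsCocycle N) {n : ℕ} (hn : 1 ≤ n) {S : ℝ} (hS : 0 < S)
    (h : ∀ x, N n x ≤ S ^ n) : ∃ C, 0 < C ∧ ∀ n x, N n x ≤ C * S ^ n := by
  obtain ⟨K, hK1, hK⟩ := hN.exists_bound n
  have hq : ∀ q r : ℕ, r ≤ n → ∀ x, N (q * n + r) x ≤ K * S ^ (q * n) := by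
    intro q r hr
    induction q with
    | zero => intro x; simpa using hK r hr x
    | succ q ih =>
      intro x
      have e : (q + 1) * n + r = n + (q * n + r) := by ring
      rw [e]
      calc _ ≤ N (q * n + r) (shift^[n] x) * N n x := hN.le_mul ..
        _ ≤ (K * S ^ (q * n)) * S ^ n := by
          gcongr
          · exact hN.nonneg _ _
          · exact ih _
          · exact h x
        _ = _ := by ring
  -- `D` restores the missing factor `S ^ r` of the remainder, which may be less than one.
  obtain ⟨D, hD0, hD⟩ : ∃ D, 0 < D ∧ ∀ r < n, (1:ℝ) ≤ D * S ^ r := by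
    refine ⟨1 + ∑ r ∈ Finset.range n, (S ^ r)⁻¹, ?_, fun r hr => ?_⟩
    · have : 0 ≤ ∑ r ∈ Finset.range n, (S ^ r)⁻¹ := Finset.sum_nonneg fun _ _ => by positivity
      linarith
    · have := Finset.single_le_sum (f := fun r => (S ^ r)⁻¹) (fun _ _ => by positivity)
        (Finset.mem_range.2 hr)
      rw [← div_le_iff₀ (by positivity), one_div]
      linarith
  refine ⟨K * D, by positivity, fun m x => ?_⟩
  have hm := Nat.div_add_mod' m n
  have hr := Nat.mod_lt m hn
  calc N m x = N (m / n * n + m % n) x := by rw [hm]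
    _ ≤ K * S ^ (m / n * n) := hq _ _ hr.le x
    _ ≤ K * S ^ (m / n * n) * (D * S ^ (m % n)) :=
      le_mul_of_one_le_right (by positivity) (hD _ hr)
    _ = K * D * S ^ (m / n * n + m % n) := by ring
    _ = _ := by rw [hm]

lemma IsCocycle.exists_isGrowthRate [Nonempty (Fin ℓ)] (hN : IsCocycle N) :
    ∃ R, IsGrowthRate N R := by
  have hmax : ∀ n, ∃ x, ∀ y, N n y ≤ N n x := fun n => by
    obtain ⟨x, -, hx⟩ := isCompact_univ.exists_isMaxOn Set.univ_nonempty (hN.cont n).continuousOn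
    exact ⟨x, fun y => hx (Set.mem_univ y)⟩
  choose z hz using hmax
  have hbdd : BddBelow (Set.range fun n : ℕ => N (n + 1) (z (n + 1)) ^ ((n + 1 : ℕ) : ℝ)⁻¹) :=
    ⟨0, by rintro _ ⟨n, rfl⟩; exact Real.rpow_nonneg (hN.nonneg _ _) _⟩
  -- By Fekete the limit is an infimum. The index starts at one because at time zero the exponent
  -- `0⁻¹ = 0` would contribute a spurious value `1`.
  refine ⟨⨅ n : ℕ, N (n + 1) (z (n + 1)) ^ ((n + 1 : ℕ) : ℝ)⁻¹,
    Real.iInf_nonneg fun n => Real.rpow_nonneg (hN.nonneg _ _) _, fun n hn => ⟨z n, ?_⟩,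
    fun S hS => ?_⟩
  · obtain ⟨n, rfl⟩ : ∃ m, n = m + 1 := ⟨n - 1, by omega⟩
    calc _ ≤ (N (n + 1) (z (n + 1)) ^ ((n + 1 : ℕ) : ℝ)⁻¹) ^ (n + 1) := by
          gcongr
          · exact Real.iInf_nonneg fun n => Real.rpow_nonneg (hN.nonneg _ _) _
          · exact ciInf_le hbdd n
      _ = _ := Real.rpow_inv_natCast_pow (hN.nonneg _ _) (by omega)
  · obtain ⟨n, hn⟩ := exists_lt_of_ciInf_lt hS
    have hS0 : 0 < S := (Real.rpow_nonneg (hN.nonneg _ _) _).trans_lt hn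
    refine hN.le_of_lt_at (n := n + 1) (by omega) hS0 fun x => ?_
    calc N (n + 1) x ≤ N (n + 1) (z (n + 1)) := hz _ x
      _ = (N (n + 1) (z (n + 1)) ^ ((n + 1 : ℕ) : ℝ)⁻¹) ^ (n + 1) :=
        (Real.rpow_inv_natCast_pow (hN.nonneg _ _) (by omega)).symm
      _ ≤ _ := by gcongr; exact Real.rpow_nonneg (hN.nonneg _ _) _

lemma IsGrowthRate.tendsto [Nonempty (Fin ℓ)] (hN : IsCocycle N) {R : ℝ} (hR : IsGrowthRate N R) :
    Tendsto (fun n : ℕ => ⨆ x, N n x ^ (n : ℝ)⁻¹) atTop (𝓝 R) := by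
  have hbdd : ∀ n : ℕ, BddAbove (Set.range fun x => N n x ^ (n : ℝ)⁻¹) := fun n => by
    obtain ⟨K, -, hK⟩ := hN.exists_bound n
    refine ⟨K ^ (n : ℝ)⁻¹, ?_⟩
    rintro _ ⟨x, rfl⟩
    exact Real.rpow_le_rpow (hN.nonneg _ _) (hK n le_rfl x) (by positivity)
  rw [tendsto_order]
  refine ⟨fun a ha => ?_, fun S hS => ?_⟩
  · filter_upwards [eventually_ge_atTop 1] with n hn
    obtain ⟨x, hx⟩ := hR.exists_le n hn
    refine ha.trans_le ((?_ : R ≤ N n x ^ (n : ℝ)⁻¹).trans (le_ciSup (hbdd n) x))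
    calc R = (R ^ n) ^ (n : ℝ)⁻¹ := (Real.pow_rpow_inv_natCast hR.nonneg (by omega)).symm
      _ ≤ _ := Real.rpow_le_rpow (by have := hR.nonneg; positivity) hx (by positivity)
  · obtain ⟨S', hS'1, hS'2⟩ := exists_between hS
    have hS'0 : 0 < S' := hR.nonneg.trans_lt hS'1
    obtain ⟨C, hC0, hC⟩ := hR.le S' hS'1
    have h1 : Tendsto (fun n : ℕ => C ^ (n : ℝ)⁻¹ * S') atTop (𝓝 (1 * S')) := by
      refine Tendsto.mul_const _ ?_
      have := (Real.continuousAt_const_rpow (a := C) (b := 0) hC0.ne').tendsto.comp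
        (tendsto_inv_atTop_zero.comp (tendsto_natCast_atTop_atTop (R := ℝ)))
      rw [Real.rpow_zero] at this
      exact this
    rw [one_mul] at h1
    filter_upwards [h1.eventually_lt_const hS'2, eventually_ge_atTop 1] with n hn hn1
    refine lt_of_le_of_lt (ciSup_le fun x => ?_) hn
    calc N n x ^ (n : ℝ)⁻¹ ≤ (C * S' ^ n) ^ (n : ℝ)⁻¹ :=
          Real.rpow_le_rpow (hN.nonneg _ _) (hC n x) (by positivity)
      _ = C ^ (n : ℝ)⁻¹ * S' := by
        rw [Real.mul_rpow hC0.le (by positivity), Real.pow_rpow_inv_natCast hS'0.le (by omega)]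

end Growth

/-- The cocycle of norms of products. -/
lemma isCocycle_norm_prodAlong {ℓ : ℕ} {M : Type*} [SeminormedRing M] (T : Fin ℓ → M) :
    IsCocycle fun n x => ‖prodAlong T x n‖ where
  nonneg _ _ := norm_nonneg _
  cont n := (continuous_prodAlong_right T n).norm
  le_mul m n x := by rw [prodAlong_add]; exact norm_mul_le _ _

lemma isGrowthRate_jointSpectralRadius {d ℓ : ℕ} [Nonempty (Fin ℓ)]
    (A : Fin ℓ → Matrix (Fin d) (Fin d) ℂ) :
    IsGrowthRate (fun n x => ‖prodAlong A x n‖) (jointSpectralRadius A) := by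
  have hN := isCocycle_norm_prodAlong A
  obtain ⟨R, hR⟩ := hN.exists_isGrowthRate
  have := (hR.tendsto hN).limsup_eq
  rw [jointSpectralRadius]
  simp_rw [partialProd_eq_prodAlong]
  rwa [this]

/-! ### Limits of invariant measures -/

section Limits

variable {X : Type*} [TopologicalSpace X] [MeasurableSpace X] [BorelSpace X]

lemma integrable_of_continuous [CompactSpace X] {f : X → ℝ} (hf : Continuous f) (μ : Measure X)
    [IsFiniteMeasure μ] : Integrable f μ := by
  obtain ⟨C, hC⟩ := isCompact_univ.bddAbove_image hf.norm.continuousOn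
  exact Integrable.of_bound hf.measurable.aestronglyMeasurable C
    (Eventually.of_forall fun x => hC ⟨x, trivial, rfl⟩)

/-- Weak convergence treats the fixed limit integrand, and uniform convergence treats the
difference. Moving integrands are needed because the cocycle itself varies with a parameter. -/
lemma tendsto_integral_of_tendsto [CompactSpace X] {ι : Type*} {F : Filter ι} {μs : ι → ProbabilityMeasure X}
    {μ : ProbabilityMeasure X} (hμ : Tendsto μs F (𝓝 μ)) {fs : ι → C(X, ℝ)} {f : C(X, ℝ)}
    (hf : Tendsto fs F (𝓝 f)) :
    Tendsto (fun k => ∫ x, fs k x ∂(μs k : Measure X)) F (𝓝 (∫ x, f x ∂(μ : Measure X))) := by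
  have h1 : Tendsto (fun k => ∫ x, f x ∂(μs k : Measure X)) F (𝓝 (∫ x, f x ∂(μ : Measure X))) :=
    ((ProbabilityMeasure.continuous_integral_continuousMap f).tendsto μ).comp hμ
  have h2 : Tendsto (fun k => ∫ x, fs k x ∂(μs k : Measure X) - ∫ x, f x ∂(μs k : Measure X))
      F (𝓝 0) := by
    refine squeeze_zero_norm (a := fun k => ‖fs k - f‖) (fun k => ?_)
      (tendsto_iff_norm_sub_tendsto_zero.1 hf)
    rw [← integral_sub (integrable_of_continuous (fs k).continuous _)
      (integrable_of_continuous f.continuous _)]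
    refine (norm_integral_le_of_norm_le_const (C := ‖fs k - f‖)
      (Eventually.of_forall fun x => ?_)).trans_eq (by simp)
    exact (fs k - f).norm_coe_le_norm x
  simpa using h2.add h1

lemma integral_comp_of_measurePreserving {σ : X → X} {μ : Measure X}
    (h : MeasurePreserving σ μ μ) {f : X → ℝ} (hf : Continuous f) :
    ∫ x, f (σ x) ∂μ = ∫ x, f x ∂μ := by
  conv_rhs => rw [← h.map_eq]
  rw [integral_map h.measurable.aemeasurable hf.measurable.aestronglyMeasurable]

lemma measurePreserving_of_forall_integral [HasOuterApproxClosed X] {σ : X → X}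
    (hσ : Continuous σ) {μ : Measure X} [IsFiniteMeasure μ]
    (h : ∀ f : C(X, ℝ), ∫ x, f (σ x) ∂μ = ∫ x, f x ∂μ) : MeasurePreserving σ μ μ := by
  refine ⟨hσ.measurable, ?_⟩
  refine ext_of_forall_integral_eq_of_IsFiniteMeasure fun f => ?_
  rw [integral_map hσ.measurable.aemeasurable f.continuous.measurable.aestronglyMeasurable]
  exact h f.toContinuousMap

lemma measurePreserving_of_tendsto [CompactSpace X] [HasOuterApproxClosed X] {σ : X → X}
    (hσ : Continuous σ) {ι : Type*} {F : Filter ι} [F.NeBot] {μs : ι → ProbabilityMeasure X}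
    {μ : ProbabilityMeasure X} (hμ : Tendsto μs F (𝓝 μ))
    (h : ∀ f : C(X, ℝ), Tendsto
      (fun k => ∫ x, f (σ x) ∂(μs k : Measure X) - ∫ x, f x ∂(μs k : Measure X)) F (𝓝 0)) :
    MeasurePreserving σ (μ : Measure X) μ := by
  refine measurePreserving_of_forall_integral hσ fun f => ?_
  have h1 := tendsto_integral_of_tendsto hμ (tendsto_const_nhds (x := f))
  have h2 := tendsto_integral_of_tendsto hμ (tendsto_const_nhds (x := f.comp ⟨σ, hσ⟩))
  have := tendsto_nhds_unique (h2.sub h1) (h f)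
  simp only [ContinuousMap.comp_apply, ContinuousMap.coe_mk] at this
  linarith

lemma measurePreserving_of_tendsto' [CompactSpace X] [HasOuterApproxClosed X] {σ : X → X}
    (hσ : Continuous σ) {ι : Type*} {F : Filter ι} [F.NeBot] {μs : ι → ProbabilityMeasure X}
    {μ : ProbabilityMeasure X} (hμ : Tendsto μs F (𝓝 μ))
    (h : ∀ᶠ k in F, MeasurePreserving σ (μs k : Measure X) (μs k)) :
    MeasurePreserving σ (μ : Measure X) μ := by
  refine measurePreserving_of_tendsto hσ hμ fun f => tendsto_const_nhds.congr' ?_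
  filter_upwards [h] with k hk
  rw [integral_comp_of_measurePreserving hk f.continuous, sub_self]

lemma exists_tendsto_of_ultrafilter [CompactSpace X] [T2Space X] {ι : Type*} (U : Ultrafilter ι)
    (μs : ι → ProbabilityMeasure X) : ∃ μ, Tendsto μs U (𝓝 μ) :=
  ⟨_, (U.map μs).le_nhds_lim⟩

/-- The empirical measure of an orbit segment. -/
lemma exists_empirical [CompactSpace X] {σ : X → X} (x : X) {n : ℕ} (hn : 1 ≤ n) :
    ∃ μ : ProbabilityMeasure X, ∀ f : X → ℝ, Continuous f →
      ∫ y, f y ∂(μ : Measure X) = birkhoffAverage ℝ σ f n x := by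
  have hn0 : (n : ENNReal) ≠ 0 := by simp; omega
  refine ⟨⟨(n : ENNReal)⁻¹ • ∑ j ∈ Finset.range n, Measure.dirac (σ^[j] x), ⟨?_⟩⟩, fun f hf => ?_⟩
  · simp [ENNReal.inv_mul_cancel hn0 (ENNReal.natCast_ne_top n)]
  · simp only [ProbabilityMeasure.coe_mk]
    rw [integral_smul_measure, integral_finsetSum_measure
      fun j _ => integrable_of_continuous hf _]
    simp only [integral_dirac' _ _ hf.measurable.stronglyMeasurable]
    simp [birkhoffAverage, birkhoffSum]

end Limits

/-! ### Maximising measures of a cocycle -/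

/-- The truncated integrals of `log N n` over `μ` are at least `n log R`. -/
def IsMax {ℓ : ℕ} (N : ℕ → (ℕ → Fin ℓ) → ℝ) (R : ℝ) (μ : Measure (ℕ → Fin ℓ)) : Prop :=
  ∀ n : ℕ, 1 ≤ n → ∀ δ : ℝ, 0 < δ → n * Real.log R ≤ ∫ x, Real.log (max (N n x) δ) ∂μ

section Maximising

variable {ℓ : ℕ} {N : ℕ → (ℕ → Fin ℓ) → ℝ}

lemma continuous_log_max {Y : Type*} [TopologicalSpace Y] {g : Y → ℝ} (hg : Continuous g) {δ : ℝ}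
    (hδ : 0 < δ) : Continuous fun x => Real.log (max (g x) δ) :=
  (hg.max continuous_const).log fun _ => (lt_max_of_lt_right hδ).ne'

lemma IsCocycle.integrable_log_max (hN : IsCocycle N) (n : ℕ) {δ : ℝ} (hδ : 0 < δ)
    (μ : Measure (ℕ → Fin ℓ)) [IsFiniteMeasure μ] :
    Integrable (fun x => Real.log (max (N n x) δ)) μ :=
  integrable_of_continuous (continuous_log_max (hN.cont n) hδ) μ

/-- It is enough to test small truncations. -/
lemma IsCocycle.le_prod (hN : IsCocycle N) {K : ℝ} (hK : ∀ x, N 0 x ≤ K) (m : ℕ) {δ : ℝ}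
    (hδ : 0 < δ) (q : ℕ) (x : ℕ → Fin ℓ) :
    N (q * m) x ≤ K * ∏ p ∈ Finset.range q, max (N m (shift^[p * m] x)) δ := by
  induction q with
  | zero => simpa using hK x
  | succ q ih =>
    rw [Nat.succ_mul, Finset.prod_range_succ]
    calc _ ≤ N m (shift^[q * m] x) * N (q * m) x := hN.le_mul ..
      _ ≤ max (N m (shift^[q * m] x)) δ *
          (K * ∏ p ∈ Finset.range q, max (N m (shift^[p * m] x)) δ) := by
        gcongr
        · exact hN.nonneg _ _
        · exact le_max_left _ _
      _ = _ := by ring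

lemma sum_range_mul_eq {α : Type*} [AddCommMonoid α] (g : ℕ → α) (q m : ℕ) :
    ∑ j ∈ Finset.range (q * m), g j =
      ∑ r ∈ Finset.range m, ∑ p ∈ Finset.range q, g (p * m + r) := by
  rw [Finset.sum_comm]
  induction q with
  | zero => simp
  | succ q ih => rw [Nat.succ_mul, Finset.sum_range_add, ih, Finset.sum_range_succ]

/-- For each offset `r < m`, cut the orbit segment into a head of length `r`, then `q` blocks of
length `m`, then a tail of length `m - r`. Summing over the `m` offsets turns the blocks into a sum
along the whole orbit. The three factors `K` bound the head, the tail and `N 0`, which need not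
equal one. -/
lemma IsCocycle.le_sum_log (hN : IsCocycle N) {K : ℝ} {m : ℕ} (hK1 : 1 ≤ K)
    (hK : ∀ n ≤ m, ∀ x, N n x ≤ K) {δ : ℝ} (hδ : 0 < δ) (q : ℕ) {x : ℕ → Fin ℓ} {R : ℝ}
    (hR : 0 < R) (h : R ^ (q * m + m) ≤ N (q * m + m) x) :
    m * ((q * m + m : ℕ) * Real.log R - 3 * Real.log K) ≤
      ∑ j ∈ Finset.range (q * m), Real.log (max (N m (shift^[j] x)) δ) := by
  have key : ∀ (f : ℕ → ℝ) (c : ℝ), (∀ r ∈ Finset.range m, c ≤ f r) →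
      m * c ≤ ∑ r ∈ Finset.range m, f r := fun f c h => by
    simpa using Finset.card_nsmul_le_sum (Finset.range m) f c h
  rw [sum_range_mul_eq]
  refine key _ _ fun r hr => ?_
  have hr : r < m := by simpa using hr
  have hpos : ∀ j, 0 < max (N m (shift^[j] x)) δ := fun j => lt_max_of_lt_right hδ
  have h1 : R ^ (q * m + m) ≤ K ^ 3 * ∏ p ∈ Finset.range q, max (N m (shift^[p * m + r] x)) δ := by
    refine h.trans ?_
    have e : q * m + m = r + (q * m + (m - r)) := by omega
    rw [e]
    have h2 := hN.le_prod (hK 0 (by omega)) m hδ q (shift^[r] x)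
    simp_rw [← Function.iterate_add_apply] at h2
    calc _ ≤ N (q * m + (m - r)) (shift^[r] x) * N r x := hN.le_mul ..
      _ ≤ (N (m - r) (shift^[q * m] (shift^[r] x)) * N (q * m) (shift^[r] x)) * N r x := by
        gcongr
        · exact hN.nonneg _ _
        · exact hN.le_mul ..
      _ ≤ (K * (K * ∏ p ∈ Finset.range q, max (N m (shift^[p * m + r] x)) δ)) * K := by
        have h3 := Finset.prod_nonneg fun p (_ : p ∈ Finset.range q) => (hpos (p * m + r)).le
        gcongr
        · exact hN.nonneg _ _
        · exact hN.nonneg _ _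
        · exact hK _ (by omega) _
        · exact hK _ (by omega) _
      _ = _ := by ring
  have h4 := Real.log_le_log (by positivity) h1
  rw [Real.log_pow, Real.log_mul (by positivity)
    (Finset.prod_ne_zero_iff.2 fun p _ => (hpos _).ne'), Real.log_pow,
    Real.log_prod fun p _ => (hpos _).ne'] at h4
  push_cast at h4 ⊢
  linarith

lemma IsCocycle.le_birkhoffAverage (hN : IsCocycle N) {R : ℝ} (hR : 0 < R) {m : ℕ}
    {δ : ℝ} (hδ : 0 < δ) : ∃ c : ℝ, ∀ n x, 1 ≤ n → m ∣ n → R ^ n ≤ N n x →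
      m * Real.log R - c / n ≤ birkhoffAverage ℝ shift (fun y => Real.log (max (N m y) δ)) n x := by
  obtain ⟨K, hK1, hK⟩ := hN.exists_bound m
  -- `3 * Real.log K` is the loss in `le_sum_log`; the last `m` terms of the average are only known
  -- to be at least `Real.log δ`.
  refine ⟨m * (3 * Real.log K - Real.log δ), fun n x hn hmn h => ?_⟩
  obtain ⟨q, rfl⟩ : ∃ q, n = q * m + m := by
    obtain ⟨q, rfl⟩ := hmn
    obtain ⟨q, rfl⟩ : ∃ p, q = p + 1 := ⟨q - 1, by
      have : q ≠ 0 := by rintro rfl; simp at hn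
      omega⟩
    exact ⟨q, by ring⟩
  have h1 := hN.le_sum_log hK1 hK hδ q hR h
  have hn0 : (0 : ℝ) < (q * m + m : ℕ) := by exact_mod_cast hn
  have h2 : m * Real.log δ ≤
      ∑ j ∈ Finset.range m, Real.log (max (N m (shift^[q * m + j] x)) δ) := by
    simpa using Finset.card_nsmul_le_sum (Finset.range m)
      (fun j => Real.log (max (N m (shift^[q * m + j] x)) δ)) (Real.log δ)
      fun r _ => Real.log_le_log hδ (le_max_right _ _)
  rw [birkhoffAverage, birkhoffSum, Finset.sum_range_add, smul_eq_mul, inv_mul_eq_div,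
    le_div_iff₀ hn0, sub_mul, div_mul_cancel₀ _ hn0.ne']
  nlinarith

lemma birkhoffAverage_comp_sub_le {X : Type*} {σ : X → X} {f : X → ℝ} {C : ℝ}
    (hC : ∀ x, |f x| ≤ C) (n : ℕ) (x : X) :
    |birkhoffAverage ℝ σ (fun y => f (σ y)) n x - birkhoffAverage ℝ σ f n x| ≤ 2 * C / n := by
  have : birkhoffAverage ℝ σ (fun y => f (σ y)) n x - birkhoffAverage ℝ σ f n x =
      (f (σ^[n] x) - f x) / n := by
    simp only [birkhoffAverage, birkhoffSum, ← Function.iterate_succ_apply', smul_eq_mul,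
      ← mul_sub, ← Finset.sum_sub_distrib]
    rw [Finset.sum_range_sub (fun k => f (σ^[k] x)), inv_mul_eq_div]
    rfl
  rw [this, abs_div, Nat.abs_cast]
  gcongr
  calc _ ≤ |f (σ^[n] x)| + |f x| := abs_sub _ _
    _ ≤ _ := by linarith [hC (σ^[n] x), hC x]

/-- Krylov-Bogoliubov: take a limit of empirical measures along orbit segments that realise `R ^ n ≤
N n x`. -/
lemma IsCocycle.exists_isMax (hN : IsCocycle N) {R : ℝ} (hR : IsGrowthRate N R) :
    ∃ μ : ProbabilityMeasure (ℕ → Fin ℓ), MeasurePreserving shift (μ : Measure (ℕ → Fin ℓ)) μ ∧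
      (0 < R → IsMax N R μ) := by
  -- Factorial lengths are eventually divisible by every `m`, as `le_birkhoffAverage` requires.
  have h1 : ∀ k : ℕ, 1 ≤ (k + 1).factorial := fun k => Nat.succ_le_of_lt (Nat.factorial_pos _)
  choose x hx using fun k : ℕ => hR.exists_le _ (h1 k)
  choose ν hν using fun k : ℕ => exists_empirical (σ := shift) (x k) (h1 k)
  obtain ⟨μ, hμ⟩ := exists_tendsto_of_ultrafilter (hyperfilter ℕ) ν
  have hfac : Tendsto (fun k : ℕ => ((k + 1).factorial : ℝ)) (hyperfilter ℕ) atTop := by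
    refine (tendsto_natCast_atTop_atTop.comp (tendsto_atTop_mono (fun k => ?_)
      tendsto_id)).mono_left Nat.hyperfilter_le_atTop
    exact (Nat.le_succ k).trans (Nat.self_le_factorial _)
  refine ⟨μ, measurePreserving_of_tendsto continuous_shift hμ fun f => ?_,
    fun hR0 m hm δ hδ => ?_⟩
  · refine squeeze_zero_norm (a := fun k : ℕ => 2 * ‖f‖ / ((k + 1).factorial : ℝ)) (fun k => ?_)
      (hfac.const_div_atTop _)
    rw [hν k _ f.continuous, hν k (fun y => f (shift y)) (f.continuous.comp continuous_shift)]
    exact birkhoffAverage_comp_sub_le (fun y => f.norm_coe_le_norm y) _ _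
  · obtain ⟨c, hc⟩ := hN.le_birkhoffAverage (m := m) hR0 hδ
    have hf := continuous_log_max (hN.cont m) hδ
    have h2 := tendsto_integral_of_tendsto hμ (tendsto_const_nhds (x := (⟨_, hf⟩ : C(_, ℝ))))
    have h3 : Tendsto (fun k : ℕ => m * Real.log R - c / ((k + 1).factorial : ℝ)) (hyperfilter ℕ)
        (𝓝 (m * Real.log R - 0)) := tendsto_const_nhds.sub (hfac.const_div_atTop _)
    rw [sub_zero] at h3
    refine le_of_tendsto_of_tendsto h3 h2 ?_
    have h4 : ∀ᶠ k in (hyperfilter ℕ : Filter ℕ), m ≤ k + 1 :=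
      ((eventually_ge_atTop m).filter_mono Nat.hyperfilter_le_atTop).mono fun k hk => by omega
    filter_upwards [h4] with k hk
    simp only [ContinuousMap.coe_mk]
    rw [hν k _ hf]
    exact hc _ _ (h1 k) (Nat.dvd_factorial (by omega) hk) (hx k)

end Maximising

/-! ### Frequencies of symbols -/

section Frequency

variable {ℓ : ℕ}

lemma isClopen_cylinder (i : Fin ℓ) : IsClopen (cylinder i) :=
  (isClopen_discrete {i}).preimage (continuous_apply 0)

lemma continuous_indicator_cylinder (i : Fin ℓ) :
    Continuous ((cylinder i).indicator fun _ => (1 : ℝ)) :=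
  continuous_const.indicator (by simp [(isClopen_cylinder i).frontier_eq])

/-- The number of occurrences of the symbol `i` among the first `n` entries of `x`. -/
def symbolCount (i : Fin ℓ) (n : ℕ) (x : ℕ → Fin ℓ) : ℝ :=
  birkhoffSum shift ((cylinder i).indicator fun _ => (1 : ℝ)) n x

lemma continuous_symbolCount (i : Fin ℓ) (n : ℕ) : Continuous (symbolCount i n) :=
  continuous_finsetSum (Finset.range n) fun j _ =>
    (continuous_indicator_cylinder i).comp (continuous_shift_iterate j)

lemma symbolCount_nonneg (i : Fin ℓ) (n : ℕ) (x : ℕ → Fin ℓ) : 0 ≤ symbolCount i n x :=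
  Finset.sum_nonneg (s := Finset.range n)
    (f := fun j => (cylinder i).indicator (fun _ => (1 : ℝ)) (shift^[j] x))
    fun _ _ => Set.indicator_nonneg (fun _ _ => zero_le_one) _

lemma symbolCount_le (i : Fin ℓ) (n : ℕ) (x : ℕ → Fin ℓ) : symbolCount i n x ≤ n := by
  simpa [symbolCount, birkhoffSum] using Finset.sum_le_card_nsmul (Finset.range n)
    (fun j => (cylinder i).indicator (fun _ => (1 : ℝ)) (shift^[j] x)) 1
    fun j _ => Set.indicator_le_self' (fun _ _ => zero_le_one) _

lemma symbolCount_add (i : Fin ℓ) (m n : ℕ) (x : ℕ → Fin ℓ) :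
    symbolCount i (m + n) x = symbolCount i n (shift^[m] x) + symbolCount i m x := by
  rw [symbolCount, birkhoffSum_add, add_comm]; rfl

lemma symbolCount_succ (i : Fin ℓ) (n : ℕ) (x : ℕ → Fin ℓ) :
    symbolCount i (n + 1) x = (if x n = i then 1 else 0) + symbolCount i n x := by
  rw [symbolCount_add]
  simp only [symbolCount, birkhoffSum, Finset.sum_range_one, Function.iterate_zero, id_eq]
  simp [Set.indicator_apply, cylinder, shift_iterate_apply]

lemma integral_symbolCount (i : Fin ℓ) (n : ℕ) {μ : Measure (ℕ → Fin ℓ)} [IsProbabilityMeasure μ]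
    (hμ : MeasurePreserving shift μ μ) :
    ∫ x, symbolCount i n x ∂μ = n * μ.real (cylinder i) := by
  have h := continuous_indicator_cylinder i
  simp only [symbolCount, birkhoffSum]
  rw [integral_finsetSum _ fun j _ => integrable_of_continuous
    (f := fun x => (cylinder i).indicator (fun _ => (1 : ℝ)) (shift^[j] x))
    (h.comp (continuous_shift_iterate j)) μ]
  simp_rw [integral_comp_of_measurePreserving (hμ.iterate _) h]
  simp [integral_indicator_const (1 : ℝ) (isClopen_cylinder i).2.measurableSet]

/-- By invariance every average count has integral `μ.real (cylinder i)`, so dominated convergence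
suffices. -/
lemma measureReal_cylinder_eq_of_ae_hasFrequency {i : Fin ℓ} {γ : ℝ} {μ : Measure (ℕ → Fin ℓ)}
    [IsProbabilityMeasure μ] (hμ : MeasurePreserving shift μ μ)
    (h : ∀ᵐ x ∂μ, HasFrequency i x γ) : μ.real (cylinder i) = γ := by
  have h1 : Tendsto (fun n : ℕ => ∫ x, (n : ℝ)⁻¹ * symbolCount i n x ∂μ) atTop
      (𝓝 (∫ _, γ ∂μ)) := by
    refine tendsto_integral_of_dominated_convergence (fun _ => 1)
      (fun n => ((continuous_symbolCount i n).const_mul _).measurable.aestronglyMeasurable)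
      (integrable_const _) (fun n => Eventually.of_forall fun x => ?_) h
    rw [Real.norm_eq_abs, abs_of_nonneg (mul_nonneg (by positivity) (symbolCount_nonneg i n x))]
    calc _ ≤ (n : ℝ)⁻¹ * n := by gcongr; exact symbolCount_le i n x
      _ ≤ 1 := by rw [mul_comm]; exact mul_inv_le_one
  rw [integral_const, probReal_univ, one_smul] at h1
  refine tendsto_nhds_unique (tendsto_const_nhds.congr' ?_) h1
  filter_upwards [eventually_ge_atTop 1] with n hn
  have hn0 : (n : ℝ) ≠ 0 := by positivity
  rw [integral_const_mul, integral_symbolCount i n hμ, ← mul_assoc, inv_mul_cancel₀ hn0, one_mul]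

end Frequency

/-! ### Twisting a cocycle by the frequency of a symbol -/

section Twist

variable {ℓ : ℕ} {N : ℕ → (ℕ → Fin ℓ) → ℝ}

/-- The cocycle weighted by `exp t` for each occurrence of `i`. -/
def twist (i : Fin ℓ) (t : ℝ) (N : ℕ → (ℕ → Fin ℓ) → ℝ) : ℕ → (ℕ → Fin ℓ) → ℝ :=
  fun n x => Real.exp (t * symbolCount i n x) * N n x

lemma IsCocycle.twist (hN : IsCocycle N) (i : Fin ℓ) (t : ℝ) : IsCocycle (twist i t N) where
  nonneg n x := mul_nonneg (Real.exp_pos _).le (hN.nonneg n x)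
  cont n := ((continuous_symbolCount i n).const_mul t).rexp.mul (hN.cont n)
  le_mul m n x := by
    simp only [OptimalRatio.twist]
    calc _ ≤ Real.exp (t * symbolCount i (m + n) x) * (N n (shift^[m] x) * N m x) := by
          gcongr; exact hN.le_mul ..
      _ = _ := by rw [symbolCount_add, mul_add, Real.exp_add]; ring

lemma twist_twist_neg (i : Fin ℓ) (t : ℝ) (N : ℕ → (ℕ → Fin ℓ) → ℝ) :
    twist i (-t) (twist i t N) = N := by
  funext n x
  simp only [twist]
  rw [← mul_assoc, ← Real.exp_add]
  simp

lemma abs_mul_symbolCount_le (i : Fin ℓ) (t : ℝ) (n : ℕ) (x : ℕ → Fin ℓ) :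
    |t * symbolCount i n x| ≤ |t| * n := by
  rw [abs_mul, abs_of_nonneg (symbolCount_nonneg i n x)]
  gcongr
  exact symbolCount_le i n x

lemma IsGrowthRate.twist_le (hN : IsCocycle N) {i : Fin ℓ} {t R R' : ℝ} (hR : IsGrowthRate N R)
    (hR' : IsGrowthRate (twist i t N) R') : R' ≤ Real.exp |t| * R := by
  suffices h : ∀ S, R < S → R' ≤ Real.exp |t| * S from
    ge_of_tendsto (((tendsto_id (x := 𝓝 R)).mono_left nhdsWithin_le_nhds).const_mul _)
      ((eventually_mem_nhdsWithin (s := Set.Ioi R)).mono h)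
  intro S hS
  obtain ⟨C, hC0, hC⟩ := hR.le S hS
  have hS0 := hR.nonneg.trans_lt hS
  refine hR'.le_of_forall_le (C := C) (by positivity) fun n x => ?_
  calc twist i t N n x ≤ Real.exp (|t| * n) * (C * S ^ n) := by
        refine mul_le_mul (Real.exp_le_exp.2 ?_) (hC n x) (hN.nonneg n x) (Real.exp_pos _).le
        exact (le_abs_self _).trans (abs_mul_symbolCount_le i t n x)
    _ = _ := by rw [mul_comm |t|, Real.exp_nat_mul, mul_pow]; ring

/-- Twisting by `-t` undoes twisting by `t`, so this is the preceding bound read backwards. -/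
lemma IsGrowthRate.le_twist (hN : IsCocycle N) {i : Fin ℓ} {t R R' : ℝ} (hR : IsGrowthRate N R)
    (hR' : IsGrowthRate (twist i t N) R') : R ≤ Real.exp |t| * R' := by
  have := IsGrowthRate.twist_le (i := i) (t := -t) (hN.twist i t) hR'
    (by rwa [twist_twist_neg])
  rwa [abs_neg] at this

/-- An integral bound for truncated logarithms. -/
lemma integral_log_max_le (hN : IsCocycle N) {μ : Measure (ℕ → Fin ℓ)} [IsProbabilityMeasure μ]
    {n : ℕ} {δ : ℝ} (hδ : 0 < δ) {g : (ℕ → Fin ℓ) → ℝ} (hg : Integrable g μ)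
    (h1 : ∀ x, N n x ≤ Real.exp (g x)) (h2 : ∀ x, δ ≤ Real.exp (g x)) :
    ∫ x, Real.log (max (N n x) δ) ∂μ ≤ ∫ x, g x ∂μ := by
  refine integral_mono (hN.integrable_log_max n hδ μ) hg fun x => ?_
  have : 0 < max (N n x) δ := lt_max_of_lt_right hδ
  exact (Real.log_le_iff_le_exp this).2 (max_le (h1 x) (h2 x))

/-- The subgradient inequality behind the twisting argument: `μ` is a competitor for the twisted
cocycle, and its mean logarithmic growth there gains exactly `t * μ.real (cylinder i)`. -/
lemma IsMax.log_add_mul_le (hN : IsCocycle N) {i : Fin ℓ} {t R R' : ℝ} (hR0 : 0 < R)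
    (hR : IsGrowthRate N R) (hR' : IsGrowthRate (twist i t N) R') {μ : Measure (ℕ → Fin ℓ)}
    [IsProbabilityMeasure μ] (hμ : MeasurePreserving shift μ μ) (hmax : IsMax N R μ) :
    Real.log R + t * μ.real (cylinder i) ≤ Real.log R' := by
  have hR'0 : 0 < R' := by
    have := hR0.trans_le (hR.le_twist hN hR')
    exact pos_of_mul_pos_right this (Real.exp_pos _).le
  suffices h : ∀ S, R' < S → Real.log R + t * μ.real (cylinder i) ≤ Real.log S from
    ge_of_tendsto ((Real.continuousAt_log hR'0.ne').tendsto.mono_left nhdsWithin_le_nhds)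
      ((eventually_mem_nhdsWithin (s := Set.Ioi R')).mono h)
  intro S hS
  obtain ⟨C, hC0, hC⟩ := hR'.le S hS
  have hS0 := hR'0.trans hS
  have key : ∀ n : ℕ, 1 ≤ n → n * (Real.log R + t * μ.real (cylinder i) - Real.log S) ≤
      Real.log C := by
    intro n hn
    have h1 := hmax n hn (Real.exp (Real.log C + n * Real.log S - |t| * n)) (Real.exp_pos _)
    -- The truncation level lies below the pointwise upper bound for `N n`, since the count of `i`
    -- is at most `n`; truncation therefore does not spoil that bound.
    have hint := (integrable_of_continuous
      ((continuous_symbolCount i n).const_mul t) μ)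
    have h2 := integral_log_max_le hN (μ := μ) (n := n)
      (δ := Real.exp (Real.log C + n * Real.log S - |t| * n)) (Real.exp_pos _)
      (g := fun x => Real.log C + n * Real.log S - t * symbolCount i n x)
      ((integrable_const _).sub hint) (fun x => ?_)
      (fun x => Real.exp_le_exp.2 (by
        have := (le_abs_self _).trans (abs_mul_symbolCount_le i t n x)
        linarith))
    · rw [integral_sub (integrable_const _) hint, integral_const_mul,
        integral_symbolCount i n hμ, integral_const, probReal_univ, one_smul] at h2
      linarith
    · have h3 := hC n x
      rw [twist, ← le_div_iff₀' (Real.exp_pos _)] at h3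
      rwa [Real.exp_sub, Real.exp_add, Real.exp_log hC0, Real.exp_nat_mul, Real.exp_log hS0]
  by_contra! hlt
  obtain ⟨n, hn⟩ := exists_nat_gt
    (Real.log C / (Real.log R + t * μ.real (cylinder i) - Real.log S))
  rw [div_lt_iff₀ (by linarith)] at hn
  have h5 := key (n + 1) (by omega)
  push_cast at h5
  linarith

end Twist

/-! ### Extended-real integrals of logarithms -/

section Ext

variable {X : Type*} [MeasurableSpace X] {μ : Measure X}

lemma toENNReal_extLog (t : ℝ) :
    (extLog t).toENNReal = ENNReal.ofReal (Real.log (max t 1)) := by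
  rw [extLog, ENNReal.log_ofReal]
  split_ifs with h
  · rw [max_eq_right (by linarith)]; simp
  · push Not at h
    rw [EReal.toENNReal_of_ne_top (EReal.coe_ne_top _), EReal.toReal_coe]
    rcases le_total t 1 with h1 | h1
    · rw [max_eq_right h1, Real.log_one, ENNReal.ofReal_zero,
        ENNReal.ofReal_of_nonpos (Real.log_nonpos h.le h1)]
    · rw [max_eq_left h1]

/-- Writes the negative part as an increasing limit of truncated ones, in the form monotone
convergence wants, including at `t = 0`. -/
lemma toENNReal_neg_extLog {t : ℝ} (ht : 0 ≤ t) :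
    (-extLog t).toENNReal =
      ⨆ k : ℕ, ENNReal.ofReal (-Real.log (min (max t (Real.exp (-k))) 1)) := by
  rw [extLog, ENNReal.log_ofReal]
  split_ifs with h
  · obtain rfl : t = 0 := le_antisymm h ht
    rw [EReal.neg_bot, EReal.toENNReal_top, eq_comm, iSup_eq_top]
    intro b hb
    obtain ⟨k, hk⟩ := ENNReal.exists_nat_gt hb.ne
    refine ⟨k, hk.trans_eq ?_⟩
    rw [max_eq_right (Real.exp_pos _).le, min_eq_left (by simp), Real.log_exp]
    simp
  · push Not at h
    rw [← EReal.coe_neg, EReal.toENNReal_of_ne_top (EReal.coe_ne_top _), EReal.toReal_coe]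
    refine le_antisymm ?_ (iSup_le fun k => ?_)
    · obtain ⟨k, hk⟩ := exists_nat_gt (-Real.log t)
      refine le_iSup_of_le k ?_
      rw [max_eq_left ((Real.exp_le_exp.2 (by linarith : -(k : ℝ) ≤ Real.log t)).trans
        (Real.exp_log h).le)]
      refine ENNReal.ofReal_le_ofReal (neg_le_neg ?_)
      exact Real.log_le_log (lt_min h one_pos) (min_le_left _ _)
    · rcases le_total t 1 with h1 | h1
      · refine ENNReal.ofReal_le_ofReal (neg_le_neg (Real.log_le_log h ?_))
        exact le_min (le_max_left _ _) h1
      · rw [min_eq_right (h1.trans (le_max_left _ _))]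
        simp

lemma log_max_eq (t : ℝ) (k : ℕ) :
    Real.log (max t (Real.exp (-k))) =
      Real.log (max t 1) - -Real.log (min (max t (Real.exp (-k))) 1) := by
  have hk : Real.exp (-(k : ℝ)) ≤ 1 := by simp
  rcases le_total t 1 with h | h
  · rw [max_eq_right h, min_eq_left (max_le h hk)]; simp
  · rw [max_eq_left h, max_eq_left (hk.trans h), min_eq_right h]; simp

/-- Monotone convergence as the truncation level `exp (-k)` tends to zero. The bound `K` keeps the
integral of the positive part finite, so the extended subtraction is never `⊤ - ⊤`. -/
lemma le_extIntegral_extLog_iff [IsProbabilityMeasure μ] {g : X → ℝ} (hg : Measurable g)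
    (hg0 : ∀ x, 0 ≤ g x) {K : ℝ} (hK : ∀ x, g x ≤ K) (c : ℝ) :
    (c : EReal) ≤ extIntegral μ (fun x => extLog (g x)) ↔
      ∀ δ, 0 < δ → c ≤ ∫ x, Real.log (max (g x) δ) ∂μ := by
  have hint : ∀ f : X → ℝ, Measurable f → ∀ a b : ℝ, (∀ x, a ≤ f x) → (∀ x, f x ≤ b) →
      Integrable f μ := fun f hf a b ha hb =>
    Integrable.of_bound hf.aestronglyMeasurable (max |a| |b|)
      (Eventually.of_forall fun x => abs_le_max_abs_abs (ha x) (hb x))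
  have hK1 : ∀ x δ, 0 < δ → Real.log (max (g x) δ) ≤ Real.log (max K δ) := fun x δ hδ =>
    Real.log_le_log (lt_max_of_lt_right hδ) (max_le_max_right _ (hK x))
  have hδ1 : ∀ x δ, 0 < δ → Real.log δ ≤ Real.log (max (g x) δ) := fun x δ hδ =>
    Real.log_le_log hδ (le_max_right _ _)
  have hintδ : ∀ δ, 0 < δ → Integrable (fun x => Real.log (max (g x) δ)) μ := fun δ hδ =>
    hint _ (hg.max measurable_const).log _ _ (fun x => hδ1 x δ hδ) (fun x => hK1 x δ hδ)
  have hv0 : ∀ (k : ℕ) x, 0 ≤ -Real.log (min (max (g x) (Real.exp (-k))) 1) := fun k x => by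
    rw [neg_nonneg]
    exact Real.log_nonpos (le_min (le_max_of_le_left (hg0 x)) zero_le_one) (min_le_right _ _)
  have hvint : ∀ k : ℕ, Integrable
      (fun x => -Real.log (min (max (g x) (Real.exp (-k))) 1)) μ := fun k => by
    refine ((hintδ 1 one_pos).sub (hintδ _ (Real.exp_pos (-k)))).congr
      (Eventually.of_forall fun x => ?_)
    have := log_max_eq (g x) k
    simp only [Pi.sub_apply]
    linarith
  have hP : ∫⁻ x, (extLog (g x)).toENNReal ∂μ =
      ENNReal.ofReal (∫ x, Real.log (max (g x) 1) ∂μ) := by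
    simp_rw [toENNReal_extLog]
    rw [ofReal_integral_eq_lintegral_ofReal (hintδ 1 one_pos)]
    exact Eventually.of_forall fun x => Real.log_nonneg (le_max_right _ _)
  have hQ : ∫⁻ x, (-extLog (g x)).toENNReal ∂μ =
      ⨆ k : ℕ, ENNReal.ofReal
        (∫ x, -Real.log (min (max (g x) (Real.exp (-k))) 1) ∂μ) := by
    simp_rw [fun x => toENNReal_neg_extLog (hg0 x)]
    rw [lintegral_iSup]
    · congr 1
      funext k
      rw [ofReal_integral_eq_lintegral_ofReal (hvint k) (Eventually.of_forall (hv0 k))]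
    · exact fun k => ((hg.max measurable_const).min measurable_const).log.neg.ennreal_ofReal
    · intro j k hjk x
      refine ENNReal.ofReal_le_ofReal (neg_le_neg (Real.log_le_log
        (lt_min (lt_max_of_lt_right (Real.exp_pos _)) one_pos) ?_))
      have : Real.exp (-(k : ℝ)) ≤ Real.exp (-(j : ℝ)) := by
        gcongr
      exact min_le_min_right _ (max_le_max_left _ this)
  have hP0 : 0 ≤ ∫ x, Real.log (max (g x) 1) ∂μ :=
    integral_nonneg fun x => Real.log_nonneg (le_max_right _ _)
  have hk : ∀ k : ℕ, ∫ x, Real.log (max (g x) (Real.exp (-k))) ∂μ =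
      ∫ x, Real.log (max (g x) 1) ∂μ -
        ∫ x, -Real.log (min (max (g x) (Real.exp (-k))) 1) ∂μ := fun k => by
    rw [← integral_sub (hintδ 1 one_pos) (hvint k)]
    simp_rw [← log_max_eq]
  have hall : (∀ δ, 0 < δ → c ≤ ∫ x, Real.log (max (g x) δ) ∂μ) ↔
      ∀ k : ℕ, c ≤ ∫ x, Real.log (max (g x) (Real.exp (-k))) ∂μ := by
    refine ⟨fun h k => h _ (Real.exp_pos _), fun h δ hδ => ?_⟩
    obtain ⟨k, hk⟩ := exists_nat_gt (-Real.log δ)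
    refine (h k).trans (integral_mono (hintδ _ (Real.exp_pos _)) (hintδ _ hδ) fun x => ?_)
    refine Real.log_le_log (lt_max_of_lt_right (Real.exp_pos _)) (max_le_max_left _ ?_)
    exact (Real.exp_le_exp.2 (by linarith : -(k : ℝ) ≤ Real.log δ)).trans (Real.exp_log hδ).le
  rw [hall, extIntegral, hP, hQ, EReal.coe_ennreal_ofReal, max_eq_left hP0]
  simp_rw [hk]
  constructor
  · intro h k
    have h1 : ((ENNReal.ofReal (∫ x, -Real.log (min (max (g x) (Real.exp (-k))) 1) ∂μ) :
        ENNReal) : EReal) ≤ _ := EReal.coe_ennreal_le_coe_ennreal_iff.2 (le_iSup (fun k : ℕ =>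
          ENNReal.ofReal (∫ x, -Real.log (min (max (g x) (Real.exp (-k))) 1) ∂μ)) k)
    rw [EReal.coe_ennreal_ofReal, max_eq_left (integral_nonneg (hv0 k))] at h1
    have h2 := h.trans (EReal.sub_le_sub le_rfl h1)
    rw [← EReal.coe_sub, EReal.coe_le_coe_iff] at h2
    exact h2
  · intro h
    have h0 : c ≤ ∫ x, Real.log (max (g x) 1) ∂μ := by
      have := h 0
      have h3 := integral_nonneg (μ := μ) (f := fun x => -Real.log (min (max (g x) (Real.exp (-(0 : ℕ)))) 1))
        (hv0 0)
      linarith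
    have h1 : (⨆ k : ℕ, ENNReal.ofReal
        (∫ x, -Real.log (min (max (g x) (Real.exp (-k))) 1) ∂μ)) ≤
        ENNReal.ofReal (∫ x, Real.log (max (g x) 1) ∂μ - c) :=
      iSup_le fun k => ENNReal.ofReal_le_ofReal (by linarith [h k])
    have h2 := EReal.coe_ennreal_le_coe_ennreal_iff.2 h1
    rw [EReal.coe_ennreal_ofReal, max_eq_left (by linarith)] at h2
    refine le_trans ?_ (EReal.sub_le_sub le_rfl h2)
    rw [← EReal.coe_sub, EReal.coe_le_coe_iff]
    linarith

end Ext

/-! ### Maximising measures of matrix families in terms of truncated integrals -/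

lemma coe_le_inv_mul_iff {a : ℝ} (ha : 0 < a) (c : ℝ) (E : EReal) :
    (c : EReal) ≤ ((a⁻¹ : ℝ) : EReal) * E ↔ ((a * c : ℝ) : EReal) ≤ E := by
  induction E with
  | bot => simp [EReal.coe_mul_bot_of_pos (inv_pos.2 ha), -EReal.coe_mul]
  | top => simp [EReal.coe_mul_top_of_pos (inv_pos.2 ha), -EReal.coe_mul]
  | coe e =>
    rw [← EReal.coe_mul, EReal.coe_le_coe_iff, EReal.coe_le_coe_iff, inv_mul_eq_div,
      le_div_iff₀ ha, mul_comm]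

lemma extLog_of_pos {t : ℝ} (ht : 0 < t) : extLog t = Real.log t := by
  rw [extLog, ENNReal.log_ofReal, if_neg (not_le.2 ht)]

lemma extLog_zero : extLog 0 = ⊥ := by simp [extLog]

/-- Half of the maximising equation holds for every probability measure, by the uniform bound `N n x
≤ C * S ^ n` for `S > R`; only the lower bound carries information. -/
lemma iInf_extIntegral_le {ℓ : ℕ} {N : ℕ → (ℕ → Fin ℓ) → ℝ} (hN : IsCocycle N) {R : ℝ}
    (hR : IsGrowthRate N R) (μ : Measure (ℕ → Fin ℓ)) [IsProbabilityMeasure μ] :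
    (⨅ n : ℕ, ⨅ _ : 1 ≤ n,
      (((n : ℝ)⁻¹ : ℝ) : EReal) * extIntegral μ (fun x => extLog (N n x))) ≤ extLog R := by
  by_contra! hlt
  obtain ⟨c, hc1, hc2⟩ := EReal.lt_iff_exists_real_btwn.1 hlt
  obtain ⟨c', hc'1, hc'2⟩ := EReal.lt_iff_exists_real_btwn.1 hc1
  have hS : R < Real.exp c' := by
    rcases hR.nonneg.eq_or_lt with h | h
    · rw [← h]; exact Real.exp_pos _
    · rw [extLog_of_pos h, EReal.coe_lt_coe_iff] at hc'1
      exact (Real.log_lt_iff_lt_exp h).1 hc'1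
  rw [EReal.coe_lt_coe_iff] at hc'2
  obtain ⟨C, hC0, hC⟩ := hR.le _ hS
  obtain ⟨n, hn⟩ := exists_nat_gt (Real.log C / (c - c'))
  rw [div_lt_iff₀ (by linarith)] at hn
  have hn1 : (0 : ℝ) < (n + 1 : ℕ) := by positivity
  have h1 : (c : EReal) ≤ ((((n + 1 : ℕ) : ℝ)⁻¹ : ℝ) : EReal) *
      extIntegral μ (fun x => extLog (N (n + 1) x)) :=
    hc2.le.trans ((iInf_le _ (n + 1)).trans (iInf_le _ (by omega)))
  rw [coe_le_inv_mul_iff hn1] at h1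
  obtain ⟨K, -, hK⟩ := hN.exists_bound (n + 1)
  rw [le_extIntegral_extLog_iff (hN.cont _).measurable (hN.nonneg _) (hK _ le_rfl)] at h1
  have h2 := integral_log_max_le hN (μ := μ) (n := n + 1)
    (δ := Real.exp (Real.log C + (n + 1 : ℕ) * c')) (Real.exp_pos _)
    (g := fun _ => Real.log C + (n + 1 : ℕ) * c') (integrable_const _)
    (fun x => (hC _ x).trans_eq (by rw [Real.exp_add, Real.exp_log hC0, Real.exp_nat_mul]))
    (fun _ => le_rfl)
  rw [integral_const, probReal_univ, one_smul] at h2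
  have h3 := (h1 _ (Real.exp_pos _)).trans h2
  push_cast at h3
  linarith

/-- When the joint spectral radius vanishes its logarithm is `⊥`, so every invariant probability
measure is maximising. This is why the condition `IsMax` is guarded by positivity. -/
lemma isMaximising_iff {d ℓ : ℕ} [Nonempty (Fin ℓ)] (A : Fin ℓ → Matrix (Fin d) (Fin d) ℂ)
    (μ : Measure (ℕ → Fin ℓ)) :
    IsMaximising A μ ↔ IsProbabilityMeasure μ ∧ MeasurePreserving shift μ μ ∧
      (0 < jointSpectralRadius A →
        IsMax (fun n x => ‖prodAlong A x n‖) (jointSpectralRadius A) μ) := by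
  rw [IsMaximising]
  simp_rw [partialProd_eq_prodAlong]
  refine and_congr_right fun hprob => and_congr_right fun _ => ?_
  have hN := isCocycle_norm_prodAlong A
  have hR := isGrowthRate_jointSpectralRadius A
  have hiff : ∀ n : ℕ, 1 ≤ n → (((Real.log (jointSpectralRadius A) : ℝ) : EReal) ≤
      (((n : ℝ)⁻¹ : ℝ) : EReal) * extIntegral μ (fun x => extLog ‖prodAlong A x n‖) ↔
      ∀ δ, 0 < δ → n * Real.log (jointSpectralRadius A) ≤
        ∫ x, Real.log (max ‖prodAlong A x n‖ δ) ∂μ) := fun n hn => by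
    obtain ⟨K, -, hK⟩ := hN.exists_bound n
    rw [coe_le_inv_mul_iff (by positivity), le_extIntegral_extLog_iff (hN.cont n).measurable
      (hN.nonneg n) (hK n le_rfl)]
  constructor
  · intro h h0 n hn
    rw [extLog_of_pos h0] at h
    exact (hiff n hn).1 (h.ge.trans ((iInf_le _ n).trans (iInf_le _ hn)))
  · intro h
    refine le_antisymm (iInf_extIntegral_le hN hR μ) (le_iInf₂ fun n hn => ?_)
    rcases hR.nonneg.eq_or_lt with h0 | h0
    · rw [← h0, extLog_zero]; exact bot_le
    · rw [extLog_of_pos h0]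
      exact (hiff n hn).2 (h h0 n hn)

/-! ### Extreme maximising measures are ergodic -/

section Ergodic

variable {ℓ : ℕ} {N : ℕ → (ℕ → Fin ℓ) → ℝ}

lemma IsCocycle.integral_log_max_mul_le (hN : IsCocycle N) {K : ℝ} (hK1 : 1 ≤ K)
    (hK : ∀ x, N 0 x ≤ K) {μ : Measure (ℕ → Fin ℓ)} [IsProbabilityMeasure μ]
    (hμ : MeasurePreserving shift μ μ) (q n : ℕ) {δ : ℝ} (hδ : 0 < δ) :
    ∫ x, Real.log (max (N (q * n) x) (δ ^ q)) ∂μ ≤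
      Real.log K + q * ∫ x, Real.log (max (N n x) δ) ∂μ := by
  have hpos : ∀ x, 0 < max (N n x) δ := fun x => lt_max_of_lt_right hδ
  have hc := continuous_log_max (hN.cont n) hδ
  have hint : ∀ p ∈ Finset.range q, Integrable
      (fun x => Real.log (max (N n (shift^[p * n] x)) δ)) μ := fun p _ =>
    integrable_of_continuous (hc.comp (continuous_shift_iterate _)) μ
  have hprod : ∀ x, Real.exp
      (Real.log K + ∑ p ∈ Finset.range q, Real.log (max (N n (shift^[p * n] x)) δ)) =
      K * ∏ p ∈ Finset.range q, max (N n (shift^[p * n] x)) δ := fun x => by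
    rw [Real.exp_add, Real.exp_log (by linarith), Real.exp_sum]
    congr 1
    exact Finset.prod_congr rfl fun p _ => Real.exp_log (hpos _)
  have h := integral_log_max_le hN (μ := μ) (n := q * n) (δ := δ ^ q) (by positivity)
    (g := fun x => Real.log K + ∑ p ∈ Finset.range q, Real.log (max (N n (shift^[p * n] x)) δ))
    ((integrable_const _).add (integrable_finsetSum _ hint))
    (fun x => by rw [hprod]; exact hN.le_prod hK n hδ q x)
    (fun x => by
      rw [hprod]
      calc δ ^ q = 1 * ∏ p ∈ Finset.range q, δ := by simp
        _ ≤ _ := by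
          gcongr
          exact le_max_right _ _)
  refine h.trans_eq ?_
  rw [integral_add (integrable_const _) (integrable_finsetSum _ hint), integral_finsetSum _ hint]
  simp_rw [fun p => integral_comp_of_measurePreserving (hμ.iterate (p * n)) hc]
  simp

/-- A defect `η` of `μ₁` at time `n` grows to about `q * η` at time `q * n` by subadditivity. The
growth rate prevents `μ₂` from compensating for it, so `μ` would fail to be maximising for large
`q`. -/
lemma IsMax.of_convex_combination (hN : IsCocycle N) {R : ℝ} (hR0 : 0 < R)
    (hR : IsGrowthRate N R) {μ μ₁ μ₂ : Measure (ℕ → Fin ℓ)}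
    [IsProbabilityMeasure μ₁] [IsProbabilityMeasure μ₂] (h₁ : MeasurePreserving shift μ₁ μ₁)
    {a b : ℝ} (ha : 0 < a) (hb : 0 ≤ b) (hab : a + b = 1)
    (h : ∀ f : (ℕ → Fin ℓ) → ℝ, Continuous f →
      ∫ x, f x ∂μ = a * ∫ x, f x ∂μ₁ + b * ∫ x, f x ∂μ₂)
    (hmax : IsMax N R μ) : IsMax N R μ₁ := by
  intro n hn δ hδ
  by_contra! hlt
  set η := n * Real.log R - ∫ x, Real.log (max (N n x) δ) ∂μ₁ with hη
  have hη0 : 0 < η := by linarith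
  have hn0 : (0 : ℝ) < n := by positivity
  -- Chosen so that the possible surplus of `μ₂`, at most `n * s` per block, is half of the weighted
  -- defect `a * η`.
  set s := a * η / (2 * n) with hs
  have hs0 : 0 < s := by positivity
  obtain ⟨C, hC0, hC⟩ := hR.le (R * Real.exp s)
    (lt_mul_of_one_lt_right hR0 (Real.one_lt_exp_iff.2 hs0))
  obtain ⟨K, hK1, hK⟩ := hN.exists_bound 0
  have key : ∀ q : ℕ, 1 ≤ q → q * (a * η / 2) ≤ Real.log K * a + Real.log C * b := by
    intro q hq
    set g := Real.log C + q * n * (Real.log R + s) with hg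
    -- One truncation low enough both for subadditivity under `μ₁` and for the pointwise bound used
    -- under `μ₂`.
    set ε := min (δ ^ q) (Real.exp g) with hε
    have hε0 : 0 < ε := lt_min (by positivity) (Real.exp_pos _)
    have e1 := hmax (q * n) (Nat.mul_pos hq hn) ε hε0
    rw [h _ (continuous_log_max (hN.cont _) hε0)] at e1
    have e2 : ∫ x, Real.log (max (N (q * n) x) ε) ∂μ₁ ≤
        Real.log K + q * ∫ x, Real.log (max (N n x) δ) ∂μ₁ := by
      refine le_trans (integral_mono (hN.integrable_log_max _ hε0 _)
        (hN.integrable_log_max _ (by positivity : 0 < δ ^ q) _) fun x => ?_)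
        (hN.integral_log_max_mul_le hK1 (hK 0 le_rfl) h₁ q n hδ)
      exact Real.log_le_log (lt_max_of_lt_right hε0) (max_le_max_left _ (min_le_left _ _))
    have e3 : ∫ x, Real.log (max (N (q * n) x) ε) ∂μ₂ ≤ g := by
      refine (integral_log_max_le hN hε0 (g := fun _ => g) (integrable_const _) (fun x => ?_)
        fun _ => min_le_right _ _).trans_eq (by simp)
      refine (hC _ x).trans_eq ?_
      rw [hg, Real.exp_add, Real.exp_log hC0, ← Nat.cast_mul, Real.exp_nat_mul, Real.exp_add,
        Real.exp_log hR0]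
    have e4 := mul_le_mul_of_nonneg_left e2 ha.le
    have e5 := mul_le_mul_of_nonneg_left e3 hb
    have hns : n * s = a * η / 2 := by rw [hs]; field_simp
    have hb1 : b ≤ 1 := by linarith
    have e6 : q * (b * (n * s)) ≤ q * (a * η / 2) := by
      rw [hns]
      have : 0 ≤ a * η / 2 := by positivity
      gcongr
      exact mul_le_of_le_one_left this hb1
    have e7 : ∫ x, Real.log (max (N n x) δ) ∂μ₁ = n * Real.log R - η := by rw [hη]; ring
    rw [e7] at e4
    rw [hg] at e5
    push_cast at e1
    obtain rfl : b = 1 - a := by linarith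
    nlinarith
  obtain ⟨q, hq⟩ := exists_nat_gt ((Real.log K * a + Real.log C * b) / (a * η / 2))
  rw [div_lt_iff₀ (by positivity)] at hq
  have := key (q + 1) (by omega)
  push_cast at this
  have : 0 < a * η / 2 := by positivity
  linarith

/-- The invariant probability measures that are maximising for `N`. -/
def maxSet (N : ℕ → (ℕ → Fin ℓ) → ℝ) (R : ℝ) : Set (ProbabilityMeasure (ℕ → Fin ℓ)) :=
  {μ | MeasurePreserving shift (μ : Measure (ℕ → Fin ℓ)) μ ∧ (0 < R → IsMax N R μ)}

lemma isClosed_maxSet (hN : IsCocycle N) (R : ℝ) : IsClosed (maxSet N R) := by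
  refine isClosed_iff_ultrafilter.2 fun μ U hU hμ => ?_
  refine ⟨measurePreserving_of_tendsto' continuous_shift (F := (U : Filter _)) (μs := id)
    (tendsto_id.mono_left hU)
    (Filter.mem_of_superset hμ fun ν hν => hν.1), fun hR n hn δ hδ => ?_⟩
  have := ProbabilityMeasure.continuous_integral_continuousMap
    (⟨_, continuous_log_max (hN.cont n) hδ⟩ : C(ℕ → Fin ℓ, ℝ))
  exact ge_of_tendsto ((this.tendsto μ).mono_left hU)
    (Filter.mem_of_superset hμ fun ν hν => hν.2 hR n hn δ hδ)

lemma measurePreserving_cond {μ : Measure (ℕ → Fin ℓ)} (hμ : MeasurePreserving shift μ μ)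
    {s : Set (ℕ → Fin ℓ)} (hs : MeasurableSet s) (hinv : shift ⁻¹' s = s) :
    MeasurePreserving shift (ProbabilityTheory.cond μ s) (ProbabilityTheory.cond μ s) := by
  have := hμ.restrict_preimage hs
  rw [hinv] at this
  exact this.smul_measure _

lemma integral_eq_cond_add_cond {μ : Measure (ℕ → Fin ℓ)} [IsProbabilityMeasure μ]
    {s : Set (ℕ → Fin ℓ)} (hs : MeasurableSet s) (h0 : μ s ≠ 0) (h1 : μ sᶜ ≠ 0)
    {f : (ℕ → Fin ℓ) → ℝ} (hf : Continuous f) :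
    ∫ x, f x ∂μ = μ.real s * ∫ x, f x ∂(ProbabilityTheory.cond μ s) +
      μ.real sᶜ * ∫ x, f x ∂(ProbabilityTheory.cond μ sᶜ) := by
  have aux : ∀ t, μ t ≠ 0 → μ.real t * ∫ x, f x ∂(ProbabilityTheory.cond μ t) =
      ∫ x in t, f x ∂μ := fun t ht => by
    rw [ProbabilityTheory.cond, integral_smul_measure, smul_eq_mul, ← mul_assoc,
      ENNReal.toReal_inv, ← measureReal_def, mul_inv_cancel₀, one_mul]
    exact (ENNReal.toReal_pos ht (measure_ne_top _ _)).ne'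
  rw [aux s h0, aux sᶜ h1, integral_add_compl hs (integrable_of_continuous hf μ)]

/-- Krein-Milman on the compact face of `maxSet` where `∫ g` is largest. An invariant set of
intermediate measure splits an extreme `μ` into its two conditional measures, and both stay in that
face. -/
lemma exists_ergodic_isMax (hN : IsCocycle N) {R : ℝ} (hR : IsGrowthRate N R) {g : C(ℕ → Fin ℓ, ℝ)} :
    ∃ μ ∈ maxSet N R, Ergodic shift (μ : Measure (ℕ → Fin ℓ)) ∧
      ∀ ν ∈ maxSet N R, ∫ x, g x ∂(ν : Measure (ℕ → Fin ℓ)) ≤ ∫ x, g x ∂(μ : Measure (ℕ → Fin ℓ)) := by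
  have hcomp : IsCompact (maxSet N R) := (isClosed_maxSet hN R).isCompact
  have hg := ProbabilityMeasure.continuous_integral_continuousMap g
  obtain ⟨μ₀, hμ₀, hμ₀max⟩ := hcomp.exists_isMaxOn (hN.exists_isMax hR) hg.continuousOn
  set v := ∫ x, g x ∂(μ₀ : Measure (ℕ → Fin ℓ)) with hv
  -- Recording all integrals of continuous functions places the measures in a locally convex vector
  -- space, where extreme points make sense.
  let φ : ProbabilityMeasure (ℕ → Fin ℓ) → C(ℕ → Fin ℓ, ℝ) → ℝ := fun μ f => ∫ x, f x ∂(μ : Measure _)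
  have hφ : Continuous φ := continuous_pi fun f =>
    ProbabilityMeasure.continuous_integral_continuousMap f
  let K := maxSet N R ∩ {μ | ∫ x, g x ∂(μ : Measure (ℕ → Fin ℓ)) = v}
  have hK : IsCompact K := hcomp.inter_right (isClosed_eq hg continuous_const)
  obtain ⟨_, ⟨μ, ⟨hμ, hμv⟩, rfl⟩, hext⟩ :=
    (hK.image hφ).extremePoints_nonempty (Set.Nonempty.image φ ⟨μ₀, hμ₀, rfl⟩)
  refine ⟨μ, hμ, ⟨hμ.1, ⟨fun s hs hinv => ?_⟩⟩, fun ν hν => (hμ₀max hν).trans_eq hμv.symm⟩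
  rw [eventuallyConst_set]
  by_contra hcon
  rw [not_or] at hcon
  have h0 : (μ : Measure (ℕ → Fin ℓ)) s ≠ 0 := fun h => hcon.2 (measure_eq_zero_iff_ae_notMem.1 h)
  have h1 : (μ : Measure (ℕ → Fin ℓ)) sᶜ ≠ 0 := fun h =>
    hcon.1 (mem_ae_iff.2 h : s ∈ ae (μ : Measure (ℕ → Fin ℓ)))
  have hinv' : shift ⁻¹' sᶜ = sᶜ := by rw [Set.preimage_compl, hinv]
  have hp1 := ProbabilityTheory.cond_isProbabilityMeasure h0
  have hp2 := ProbabilityTheory.cond_isProbabilityMeasure h1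
  have hm1 := measurePreserving_cond hμ.1 hs hinv
  have hm2 := measurePreserving_cond hμ.1 hs.compl hinv'
  have ha : 0 < (μ : Measure (ℕ → Fin ℓ)).real s := ENNReal.toReal_pos h0 (measure_ne_top _ _)
  have hb : 0 < (μ : Measure (ℕ → Fin ℓ)).real sᶜ := ENNReal.toReal_pos h1 (measure_ne_top _ _)
  have hab : (μ : Measure (ℕ → Fin ℓ)).real s + (μ : Measure (ℕ → Fin ℓ)).real sᶜ = 1 := by
    rw [measureReal_add_measureReal_compl hs, probReal_univ]
  have hsplit := fun (f : (ℕ → Fin ℓ) → ℝ) (hf : Continuous f) =>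
    integral_eq_cond_add_cond (μ := (μ : Measure (ℕ → Fin ℓ))) hs h0 h1 hf
  let μ₁ : ProbabilityMeasure (ℕ → Fin ℓ) := ⟨_, hp1⟩
  let μ₂ : ProbabilityMeasure (ℕ → Fin ℓ) := ⟨_, hp2⟩
  have hM1 : μ₁ ∈ maxSet N R := ⟨hm1, fun h =>
    (hμ.2 h).of_convex_combination hN h hR hm1 ha hb.le hab hsplit⟩
  have hM2 : μ₂ ∈ maxSet N R := ⟨hm2, fun h =>
    (hμ.2 h).of_convex_combination hN h hR hm2 hb ha.le (by linarith)
      fun f hf => (hsplit f hf).trans (add_comm _ _)⟩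
  have hle1 : ∫ x, g x ∂(μ₁ : Measure (ℕ → Fin ℓ)) ≤ v := hμ₀max hM1
  have hle2 : ∫ x, g x ∂(μ₂ : Measure (ℕ → Fin ℓ)) ≤ v := hμ₀max hM2
  have hgs : v = _ := (hμv.symm.trans (hsplit g g.continuous) : _)
  have hv1 : ∫ x, g x ∂(μ₁ : Measure (ℕ → Fin ℓ)) = v := by
    refine le_antisymm hle1 ?_
    by_contra! hlt
    have := mul_lt_mul_of_pos_left hlt ha
    have := mul_le_mul_of_nonneg_left hle2 hb.le
    have e : v = (μ : Measure (ℕ → Fin ℓ)).real s * v + (μ : Measure (ℕ → Fin ℓ)).real sᶜ * v := by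
      rw [← add_mul, hab, one_mul]
    simp only [μ₁, μ₂, ProbabilityMeasure.coe_mk] at *
    linarith
  have hv2 : ∫ x, g x ∂(μ₂ : Measure (ℕ → Fin ℓ)) = v := by
    refine le_antisymm hle2 ?_
    by_contra! hlt
    have := mul_lt_mul_of_pos_left hlt hb
    have := mul_le_mul_of_nonneg_left hle1 ha.le
    have e : v = (μ : Measure (ℕ → Fin ℓ)).real s * v + (μ : Measure (ℕ → Fin ℓ)).real sᶜ * v := by
      rw [← add_mul, hab, one_mul]
    simp only [μ₁, μ₂, ProbabilityMeasure.coe_mk] at *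
    linarith
  have hseg : φ μ ∈ openSegment ℝ (φ μ₁) (φ μ₂) :=
    ⟨_, _, ha, hb, hab, funext fun f => (hsplit f f.continuous).symm⟩
  have heq := hext ⟨μ₁, ⟨hM1, hv1⟩, rfl⟩ ⟨μ₂, ⟨hM2, hv2⟩, rfl⟩ hseg
  have hμ1 : (μ₁ : Measure (ℕ → Fin ℓ)) = μ :=
    ext_of_forall_integral_eq_of_IsFiniteMeasure fun f => congrFun heq f.toContinuousMap
  -- Extremality identifies `μ` with its conditioning on `s`, which gives `sᶜ` measure zero.
  apply h1
  rw [← hμ1]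
  simp [μ₁, ProbabilityTheory.cond_apply hs]

end Ergodic

/-! ### Almost sure behaviour under maximising measures -/

section AlmostSure

variable {ℓ : ℕ} {N : ℕ → (ℕ → Fin ℓ) → ℝ}

/-- If `N` is bounded by multiples of `R ^ n`, almost every point of a maximising measure has
`N n x ≥ ε R ^ n`. -/
lemma IsMax.ae_exists_le (hN : IsCocycle N) {R C : ℝ} (hR0 : 0 < R) (hC1 : 1 ≤ C)
    (hC : ∀ n x, N n x ≤ C * R ^ n) {μ : Measure (ℕ → Fin ℓ)} [IsProbabilityMeasure μ]
    (hmax : IsMax N R μ) : ∀ᵐ x ∂μ, ∃ ε, 0 < ε ∧ ∀ n, 1 ≤ n → ε * R ^ n ≤ N n x := by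
  set G : Set (ℕ → Fin ℓ) := ⋃ k : ℕ, ⋂ n : ℕ, ⋂ _ : 1 ≤ n,
    {x | ((k : ℝ) + 1)⁻¹ * R ^ n ≤ N n x} with hG
  have hGm : MeasurableSet G := MeasurableSet.iUnion fun k => MeasurableSet.iInter fun n =>
    MeasurableSet.iInter fun _ => measurableSet_le measurable_const (hN.cont n).measurable
  suffices h : μ Gᶜ = 0 by
    filter_upwards [measure_eq_zero_iff_ae_notMem.1 h] with x hx
    rw [Set.mem_compl_iff, not_not, hG] at hx
    simp only [Set.mem_iUnion, Set.mem_iInter] at hx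
    obtain ⟨k, hk⟩ := hx
    exact ⟨_, by positivity, hk⟩
  have hC0 : 0 < C := by linarith
  -- Off `G` the ratio `N n x / R ^ n` comes arbitrarily close to zero at some time;
  -- submultiplicativity and the constant `C` keep it small from then on.
  have hzero : ∀ x ∈ Gᶜ, Tendsto (fun n => N n x / R ^ n) atTop (𝓝 0) := by
    intro x hx
    rw [hG] at hx
    simp only [Set.mem_compl_iff, Set.mem_iUnion, Set.mem_iInter, Set.mem_ofPred_eq,
      not_exists, not_forall, not_le] at hx
    rw [Metric.tendsto_atTop]
    intro η hη
    obtain ⟨k, hk⟩ := exists_nat_gt (C / η)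
    obtain ⟨m, hm, hlt⟩ := hx k
    refine ⟨m, fun n hn => ?_⟩
    obtain ⟨j, rfl⟩ := Nat.exists_eq_add_of_le hn
    rw [Real.dist_0_eq_abs, abs_of_nonneg (div_nonneg (hN.nonneg _ _) (by positivity)),
      div_lt_iff₀ (by positivity)]
    have hk' : C * ((k : ℝ) + 1)⁻¹ < η := by
      rw [← div_eq_mul_inv, div_lt_iff₀ (by positivity), mul_comm]
      rw [div_lt_iff₀ hη] at hk
      linarith
    calc N (m + j) x ≤ N j (shift^[m] x) * N m x := hN.le_mul ..
      _ ≤ (C * R ^ j) * (((k : ℝ) + 1)⁻¹ * R ^ m) := by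
        gcongr
        · exact hN.nonneg _ _
        · exact hC _ _
      _ = (C * ((k : ℝ) + 1)⁻¹) * R ^ (m + j) := by ring
      _ < η * R ^ (m + j) := by gcongr
  -- The truncated logarithm of `N n x / R ^ n` has nonnegative integral, is at most `log C`, and
  -- tends to `-k` on `Gᶜ`.
  have key : ∀ k : ℕ, k * μ.real Gᶜ ≤ Real.log C := by
    intro k
    have hδ : (0 : ℝ) < Real.exp (-k) := Real.exp_pos _
    have hcont : ∀ n, Continuous fun x => Real.log (max (N n x / R ^ n) (Real.exp (-k))) :=
      fun n => continuous_log_max ((hN.cont n).div_const _) hδ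
    have hup : ∀ n x, Real.log (max (N n x / R ^ n) (Real.exp (-k))) ≤ Real.log C := fun n x => by
      refine Real.log_le_log (lt_max_of_lt_right hδ) (max_le ?_ ?_)
      · exact (div_le_iff₀ (by positivity)).2 (hC n x)
      · exact le_trans (by simp) hC1
    have hlow : ∀ n x, -(k : ℝ) ≤ Real.log (max (N n x / R ^ n) (Real.exp (-k))) := fun n x => by
      conv_lhs => rw [← Real.log_exp (-k)]
      exact Real.log_le_log hδ (le_max_right _ _)
    have hnn : ∀ n : ℕ, 1 ≤ n →
        0 ≤ ∫ x, Real.log (max (N n x / R ^ n) (Real.exp (-k))) ∂μ := by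
      intro n hn
      have h1 := hmax n hn (R ^ n * Real.exp (-k)) (by positivity)
      have h2 : ∀ x, Real.log (max (N n x) (R ^ n * Real.exp (-k))) =
          n * Real.log R + Real.log (max (N n x / R ^ n) (Real.exp (-k))) := fun x => by
        rw [← Real.log_pow, ← Real.log_mul (by positivity) (lt_max_of_lt_right hδ).ne',
          mul_max_of_nonneg _ _ (by positivity), mul_div_cancel₀ _ (by positivity)]
      simp_rw [h2] at h1
      rw [integral_add (integrable_const _) (integrable_of_continuous (hcont n) μ),
        integral_const, probReal_univ, one_smul] at h1
      linarith
    have hlim : Tendsto (fun n => ∫ x in Gᶜ, Real.log (max (N n x / R ^ n) (Real.exp (-k))) ∂μ)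
        atTop (𝓝 (∫ _ in Gᶜ, -(k : ℝ) ∂μ)) := by
      refine tendsto_integral_of_dominated_convergence (fun _ => max |-(k : ℝ)| |Real.log C|)
        (fun n => (hcont n).measurable.aestronglyMeasurable) (integrable_const _)
        (fun n => Eventually.of_forall fun x => abs_le_max_abs_abs (hlow n x) (hup n x)) ?_
      refine (ae_restrict_iff' hGm.compl).2 (Eventually.of_forall fun x hx => ?_)
      have h3 : Tendsto (fun n => max (N n x / R ^ n) (Real.exp (-k))) atTop
          (𝓝 (max 0 (Real.exp (-k)))) := (hzero x hx).max tendsto_const_nhds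
      rw [max_eq_right hδ.le] at h3
      have h4 := (Real.continuousAt_log hδ.ne').tendsto.comp h3
      rwa [Real.log_exp] at h4
    rw [setIntegral_const, smul_eq_mul] at hlim
    have h5 : ∀ n : ℕ, 1 ≤ n → -Real.log C ≤
        ∫ x in Gᶜ, Real.log (max (N n x / R ^ n) (Real.exp (-k))) ∂μ := by
      intro n hn
      have h6 := hnn n hn
      rw [← integral_add_compl hGm (integrable_of_continuous (hcont n) μ)] at h6
      have h7 : ∫ x in G, Real.log (max (N n x / R ^ n) (Real.exp (-k))) ∂μ ≤
          ∫ _ in G, Real.log C ∂μ :=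
        integral_mono (integrable_of_continuous (hcont n) _) (integrable_const _) (hup n)
      rw [setIntegral_const, smul_eq_mul] at h7
      have h8 : μ.real G * Real.log C ≤ Real.log C :=
        mul_le_of_le_one_left (Real.log_nonneg hC1) measureReal_le_one
      linarith
    have := ge_of_tendsto hlim ((eventually_ge_atTop 1).mono h5)
    linarith
  by_contra hne
  have hpos : 0 < μ.real Gᶜ := ENNReal.toReal_pos hne (measure_ne_top _ _)
  obtain ⟨k, hk⟩ := exists_nat_gt (Real.log C / μ.real Gᶜ)
  rw [div_lt_iff₀ hpos] at hk
  exact absurd (key k) (not_le.2 hk)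

/-- A set whose visits force exponential decay relative to `R ^ n` is null for maximising
measures. -/
lemma IsMax.measure_eq_zero_of_decay (hN : IsCocycle N) {R C a : ℝ} (hR0 : 0 < R) (hC0 : 0 < C)
    (ha : 0 < a) {m : ℕ} (hm : 1 ≤ m) {E : Set (ℕ → Fin ℓ)} (hE : MeasurableSet E)
    (h : ∀ q x, N (q * m) x ≤ C * R ^ (q * m) *
      Real.exp (-(a * ∑ j ∈ Finset.range q, E.indicator (fun _ => (1 : ℝ)) (shift^[j * m] x))))
    {μ : Measure (ℕ → Fin ℓ)} [IsProbabilityMeasure μ] (hμ : MeasurePreserving shift μ μ)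
    (hmax : IsMax N R μ) : μ E = 0 := by
  set ind : (ℕ → Fin ℓ) → ℝ := E.indicator (fun _ => (1 : ℝ)) with hinddef
  have hindint : Integrable ind μ := (integrable_const (1 : ℝ)).indicator hE
  have hind0 : ∀ x, ind x ≤ 1 := fun x => Set.indicator_le_self' (fun _ _ => zero_le_one) x
  have hI : ∀ j, Integrable (fun x => ind (shift^[j * m] x)) μ := fun j =>
    (hμ.iterate (j * m)).integrable_comp_of_integrable hindint
  have hIe : ∀ j, ∫ x, ind (shift^[j * m] x) ∂μ = μ.real E := fun j => by
    have h1 := hμ.iterate (j * m)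
    have h2 : ∫ y, ind y ∂(Measure.map (shift^[j * m]) μ) = ∫ x, ind (shift^[j * m] x) ∂μ :=
      integral_map h1.measurable.aemeasurable (by rw [h1.map_eq]; exact hindint.1)
    rw [← h2, h1.map_eq, hinddef, integral_indicator_const (1 : ℝ) hE, smul_eq_mul, mul_one]
  have key : ∀ q : ℕ, 1 ≤ q → q * (a * μ.real E) ≤ Real.log C := by
    intro q hq
    have hexp : ∀ s : ℝ, Real.exp (Real.log C + (q * m : ℕ) * Real.log R - a * s) =
        C * R ^ (q * m) * Real.exp (-(a * s)) := fun s => by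
      rw [sub_eq_add_neg, Real.exp_add, Real.exp_add, Real.exp_log hC0, Real.exp_nat_mul,
        Real.exp_log hR0]
    have hsum := integrable_finsetSum (Finset.range q) fun j _ => hI j
    have h1 := integral_log_max_le hN (μ := μ) (n := q * m)
      (δ := Real.exp (Real.log C + (q * m : ℕ) * Real.log R - a * q)) (Real.exp_pos _)
      (g := fun x => Real.log C + (q * m : ℕ) * Real.log R -
        a * ∑ j ∈ Finset.range q, ind (shift^[j * m] x))
      ((integrable_const _).sub (hsum.const_mul a))
      (fun x => by rw [hexp]; exact h q x)
      (fun x => Real.exp_le_exp.2 (by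
        have : ∑ j ∈ Finset.range q, ind (shift^[j * m] x) ≤ q := by
          simpa using Finset.sum_le_card_nsmul (Finset.range q)
            (fun j => ind (shift^[j * m] x)) 1 fun j _ => hind0 _
        have := mul_le_mul_of_nonneg_left this ha.le
        linarith))
    rw [integral_sub (integrable_const _) (hsum.const_mul a), integral_const_mul,
      integral_finsetSum _ fun j _ => hI j] at h1
    simp only [hIe, integral_const, probReal_univ, one_smul, Finset.sum_const, Finset.card_range,
      nsmul_eq_mul] at h1
    have h2 := hmax (q * m) (Nat.mul_pos hq hm) _ (Real.exp_pos
      (Real.log C + (q * m : ℕ) * Real.log R - a * q))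
    linarith
  by_contra hne
  have hpos : 0 < a * μ.real E := mul_pos ha (ENNReal.toReal_pos hne (measure_ne_top _ _))
  obtain ⟨k, hk⟩ := exists_nat_gt (Real.log C / (a * μ.real E))
  rw [div_lt_iff₀ hpos] at hk
  have := key (k + 1) (by omega)
  push_cast at this
  linarith

end AlmostSure

/-! ### Extremal norms and vectors of exact growth -/

section Seminorm

variable {ℓ : ℕ} {V : Type*} [NormedAddCommGroup V] [NormedSpace ℂ V]

lemma prodAlong_succ_apply (T : Fin ℓ → V →L[ℂ] V) (x : ℕ → Fin ℓ) (n : ℕ) (v : V) :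
    prodAlong T x (n + 1) v = T (x n) (prodAlong T x n v) := rfl

lemma prodAlong_succ_apply' (T : Fin ℓ → V →L[ℂ] V) (x : ℕ → Fin ℓ) (n : ℕ) (v : V) :
    prodAlong T x (n + 1) v = prodAlong T (shift x) n (T (x 0) v) := by
  rw [prodAlong_succ']; rfl

lemma prodAlong_add_apply (T : Fin ℓ → V →L[ℂ] V) (x : ℕ → Fin ℓ) (m n : ℕ) (v : V) :
    prodAlong T x (m + n) v = prodAlong T (shift^[m] x) n (prodAlong T x m v) := by
  rw [prodAlong_add]; rfl

lemma seminorm_prodAlong_le {p : Seminorm ℂ V} {R : ℝ} (hR : 0 ≤ R) {T : Fin ℓ → V →L[ℂ] V}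
    (hT : ∀ k v, p (T k v) ≤ R * p v) (x : ℕ → Fin ℓ) (n : ℕ) (v : V) :
    p (prodAlong T x n v) ≤ R ^ n * p v := by
  induction n with
  | zero => simp
  | succ n ih =>
    rw [prodAlong_succ_apply, pow_succ']
    calc _ ≤ R * p (prodAlong T x n v) := hT _ _
      _ ≤ R * (R ^ n * p v) := by gcongr
      _ = _ := by ring

/-- Split time into blocks of length `m`: each block starting in `E` contributes an extra factor
`exp (-a)`, and the others contribute at most `R ^ m`. -/
lemma seminorm_prodAlong_mul_le {p : Seminorm ℂ V} {R : ℝ} (hR : 0 ≤ R) {T : Fin ℓ → V →L[ℂ] V}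
    (hT : ∀ k v, p (T k v) ≤ R * p v) {m : ℕ} {a : ℝ} {E : Set (ℕ → Fin ℓ)}
    (hE : ∀ x ∈ E, ∀ v, p (prodAlong T x m v) ≤ Real.exp (-a) * R ^ m * p v)
    (q : ℕ) (x : ℕ → Fin ℓ) (v : V) :
    p (prodAlong T x (q * m) v) ≤ R ^ (q * m) * Real.exp
      (-(a * ∑ j ∈ Finset.range q, E.indicator (fun _ => (1 : ℝ)) (shift^[j * m] x))) * p v := by
  induction q with
  | zero => simp
  | succ q ih =>
    rw [Nat.succ_mul, prodAlong_add_apply, Finset.sum_range_succ]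
    have h1 : ∀ w, p (prodAlong T (shift^[q * m] x) m w) ≤
        Real.exp (-(a * E.indicator (fun _ => (1 : ℝ)) (shift^[q * m] x))) * R ^ m * p w := by
      intro w
      by_cases hx : shift^[q * m] x ∈ E
      · simpa [hx] using hE _ hx w
      · simpa [hx] using seminorm_prodAlong_le hR hT (shift^[q * m] x) m w
    refine (h1 _).trans ((mul_le_mul_of_nonneg_left ih (by positivity)).trans_eq ?_)
    rw [mul_add, neg_add, Real.exp_add]
    ring

variable [FiniteDimensional ℂ V]

lemma continuous_seminorm (p : Seminorm ℂ V) : Continuous p :=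
  continuousOn_univ.1 ((p.restrictScalars ℝ).convexOn.continuousOn isOpen_univ)

lemma exists_norm_le_mul_seminorm (p : Seminorm ℂ V) (hp : ∀ v, p v = 0 → v = 0) :
    ∃ c, 0 < c ∧ ∀ v, ‖v‖ ≤ c * p v := by
  have : ProperSpace V := FiniteDimensional.proper ℂ V
  rcases subsingleton_or_nontrivial V with h | h
  · exact ⟨1, one_pos, fun v => by simp [Subsingleton.elim v 0]⟩
  have hne : (Metric.sphere (0 : V) 1).Nonempty := by
    obtain ⟨v, hv⟩ := exists_norm_eq V zero_le_one
    exact ⟨v, by simpa using hv⟩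
  obtain ⟨u, hu, hmin⟩ := (isCompact_sphere (0 : V) 1).exists_isMinOn hne
    (continuous_seminorm p).continuousOn
  have hu0 : u ≠ 0 := by rintro rfl; simp at hu
  have hpu : 0 < p u := (apply_nonneg p u).lt_of_ne fun h => hu0 (hp u h.symm)
  refine ⟨(p u)⁻¹, inv_pos.2 hpu, fun v => ?_⟩
  rcases eq_or_ne v 0 with rfl | hv
  · simp
  have hv0 : 0 < ‖v‖ := norm_pos_iff.2 hv
  have h1 : p u ≤ p (((‖v‖⁻¹ : ℝ) : ℂ) • v) := hmin (by
    simp [norm_smul, hv0.ne'])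
  rw [map_smul_eq_mul, Complex.norm_real, norm_inv, norm_norm, inv_mul_eq_div,
    le_div_iff₀ hv0] at h1
  rw [inv_mul_eq_div, le_div_iff₀ hpu]
  linarith

lemma exists_opNorm_le (p : Seminorm ℂ V) (hp : ∀ v, p v = 0 → v = 0) :
    ∃ C, 0 < C ∧ ∀ (f : V →L[ℂ] V) (b : ℝ), 0 ≤ b → (∀ v, p (f v) ≤ b * p v) → ‖f‖ ≤ C * b := by
  obtain ⟨c, hc0, hc⟩ := exists_norm_le_mul_seminorm p hp
  obtain ⟨D, hD0, hD⟩ := p.bound_of_continuous_normedSpace (continuous_seminorm p)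
  refine ⟨c * D, by positivity, fun f b hb h => f.opNorm_le_bound (by positivity) fun v => ?_⟩
  calc ‖f v‖ ≤ c * p (f v) := hc _
    _ ≤ c * (b * (D * ‖v‖)) := by
      gcongr
      exact (h v).trans (by gcongr; exact hD v)
    _ = _ := by ring

/-- For an extremal norm, almost every point of a maximising measure carries a vector along whose
orbit the norm grows exactly like `R ^ n`. -/
lemma IsMax.ae_exists_seminorm_eq {p : Seminorm ℂ V} (hp : ∀ v, p v = 0 → v = 0) {R : ℝ}
    (hR0 : 0 < R) {T : Fin ℓ → V →L[ℂ] V} (hT : ∀ k v, p (T k v) ≤ R * p v)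
    {μ : Measure (ℕ → Fin ℓ)} [IsProbabilityMeasure μ] (hμ : MeasurePreserving shift μ μ)
    (hmax : IsMax (fun n x => ‖prodAlong T x n‖) R μ) :
    ∀ᵐ x ∂μ, ∃ v, p v = 1 ∧ ∀ n, p (prodAlong T x n v) = R ^ n := by
  have hN := isCocycle_norm_prodAlong T
  obtain ⟨C, hC0, hC⟩ := exists_opNorm_le p hp
  have hpc := continuous_seminorm p
  -- `E m` consists of the points for which every vector has lost a definite factor by time `m`.
  -- Each visit costs this factor again, so `E m` is null for `m ≥ 1`.
  set E : ℕ → Set (ℕ → Fin ℓ) := fun m =>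
    {x | ∀ v, p (prodAlong T x m v) ≤ Real.exp (-((m : ℝ) + 1)⁻¹) * R ^ m * p v} with hE
  have hEm : ∀ m, MeasurableSet (E m) := fun m => by
    have : E m = ⋂ v, {x | p (prodAlong T x m v) ≤ Real.exp (-((m : ℝ) + 1)⁻¹) * R ^ m * p v} := by
      ext x; simp [hE]
    rw [this]
    refine (isClosed_iInter fun v => isClosed_le ?_ continuous_const).measurableSet
    exact hpc.comp ((continuous_prodAlong_right T m).clm_apply continuous_const)
  have hnull : ∀ m, 1 ≤ m → μ (E m) = 0 := fun m hm =>
    hmax.measure_eq_zero_of_decay hN hR0 hC0 (by positivity : (0 : ℝ) < ((m : ℝ) + 1)⁻¹) hm (hEm m)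
      (fun q x => (hC _ _ (by positivity)
        (seminorm_prodAlong_mul_le hR0.le hT (E := E m) (a := ((m : ℝ) + 1)⁻¹) (fun x hx => hx) q x)).trans_eq (by ring)) hμ
  have hall : ∀ᵐ x ∂μ, ∀ m, 1 ≤ m → x ∉ E m :=
    ae_all_iff.2 fun m => by
      by_cases hm : 1 ≤ m
      · filter_upwards [measure_eq_zero_iff_ae_notMem.1 (hnull m hm)] with x hx _ using hx
      · exact Eventually.of_forall fun x h => absurd h hm
  filter_upwards [hall] with x hx
  have : ProperSpace V := FiniteDimensional.proper ℂ V
  obtain ⟨c, hc0, hc⟩ := exists_norm_le_mul_seminorm p hp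
  -- The factors `exp (-(m + 2)⁻¹)` increase with `m`, which together with `hT` makes these compact
  -- sets nested; a common point is the required vector.
  let t : ℕ → Set V := fun m => {v | p v = 1} ∩
    {v | Real.exp (-((m : ℝ) + 2)⁻¹) * R ^ (m + 1) ≤ p (prodAlong T x (m + 1) v)}
  have hcl : ∀ m, IsClosed (t m) := fun m =>
    (isClosed_eq hpc continuous_const).inter
      (isClosed_le continuous_const (hpc.comp (prodAlong T x (m + 1)).continuous))
  have hsphere : IsCompact {v | p v = 1} := by
    refine Metric.isCompact_of_isClosed_isBounded (isClosed_eq hpc continuous_const) ?_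
    refine (Metric.isBounded_closedBall (x := (0 : V)) (r := c)).subset fun v hv => ?_
    have := hc v
    rw [show p v = 1 from hv, mul_one] at this
    simpa using this
  have hstep : ∀ (m : ℕ) (v : V), Real.exp (-((m : ℝ) + 1 + 2)⁻¹) * R ^ (m + 1 + 1) ≤
      p (prodAlong T x (m + 1 + 1) v) →
      Real.exp (-((m : ℝ) + 2)⁻¹) * R ^ (m + 1) ≤ p (prodAlong T x (m + 1) v) := by
    intro m v h
    rw [prodAlong_succ_apply] at h
    have h1 := h.trans (hT _ _)
    rw [pow_succ' R (m + 1), mul_left_comm] at h1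
    refine le_trans ?_ (le_of_mul_le_mul_left h1 hR0)
    gcongr
    linarith
  obtain ⟨v, hv⟩ := IsCompact.nonempty_iInter_of_sequence_nonempty_isCompact_isClosed t
    (fun m v hv => ⟨hv.1, hstep m v (by have := hv.2; simp only [Set.mem_ofPred_eq] at this; push_cast at this; exact this)⟩)
    (fun m => by
      have h1 := hx (m + 1) (by omega)
      simp only [hE, Set.mem_ofPred_eq, not_forall, not_le] at h1
      obtain ⟨v, hv⟩ := h1
      have hpv : 0 < p v := by
        refine (apply_nonneg p v).lt_of_ne fun h0 => ?_
        rw [hp v h0.symm] at hv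
        simp at hv
      refine ⟨(((p v)⁻¹ : ℝ) : ℂ) • v, ?_, ?_⟩
      · simp only [Set.mem_ofPred_eq]
        rw [map_smul_eq_mul, Complex.norm_real, norm_inv, Real.norm_of_nonneg hpv.le,
          inv_mul_cancel₀ hpv.ne']
      · simp only [Set.mem_ofPred_eq]
        rw [map_smul, map_smul_eq_mul, Complex.norm_real, norm_inv, Real.norm_of_nonneg hpv.le,
          inv_mul_eq_div, le_div_iff₀ hpv]
        push_cast at hv
        rw [add_assoc, one_add_one_eq_two] at hv
        exact hv.le)
    (hsphere.of_isClosed_subset (hcl 0) Set.inter_subset_left) hcl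
  rw [Set.mem_iInter] at hv
  have hpv : p v = 1 := (hv 0).1
  refine ⟨v, hpv, fun n => le_antisymm ?_ ?_⟩
  · simpa [hpv] using seminorm_prodAlong_le hR0.le hT x n v
  · have hlow : ∀ j : ℕ, Real.exp (-(((n + j : ℕ) : ℝ) + 2)⁻¹) * R ^ n ≤ p (prodAlong T x n v) := by
      intro j
      have h1 : Real.exp (-(((n + j : ℕ) : ℝ) + 2)⁻¹) * R ^ (n + j + 1) ≤
        p (prodAlong T x (n + j + 1) v) := (hv (n + j)).2
      rw [add_assoc, prodAlong_add_apply] at h1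
      have h2 := h1.trans (seminorm_prodAlong_le hR0.le hT (shift^[n] x) (j + 1) _)
      rw [pow_add, ← mul_assoc, mul_comm (R ^ (j + 1))] at h2
      exact le_of_mul_le_mul_right h2 (by positivity)
    have hlim : Tendsto (fun j : ℕ => Real.exp (-(((n + j : ℕ) : ℝ) + 2)⁻¹) * R ^ n) atTop
        (𝓝 (Real.exp (-0) * R ^ n)) := by
      have h3 : Tendsto (fun j : ℕ => (((n + j : ℕ) : ℝ) + 2)) atTop atTop :=
        tendsto_atTop_add_const_right _ _ (tendsto_natCast_atTop_atTop.comp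
          (tendsto_atTop_mono (fun j => Nat.le_add_left j n) tendsto_id))
      exact ((Real.continuous_exp.tendsto _).comp
        (tendsto_inv_atTop_zero.comp h3).neg).mul_const _
    rw [neg_zero, Real.exp_zero, one_mul] at hlim
    exact le_of_tendsto' hlim hlow

end Seminorm

/-! ### Block triangular families -/

section Splitting

variable {ℓ : ℕ} {V W Q : Type*} [NormedAddCommGroup V] [NormedSpace ℂ V]
  [NormedAddCommGroup W] [NormedSpace ℂ W] [NormedAddCommGroup Q] [NormedSpace ℂ Q]

/-- The family `T` is block triangular with diagonal blocks `B` (on the invariant subspace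
`ι : W → V`) and `C` (on the quotient `q : V → Q`, with section `j`). -/
structure IsSplitting (T : Fin ℓ → V →L[ℂ] V) (B : Fin ℓ → W →L[ℂ] W) (C : Fin ℓ → Q →L[ℂ] Q)
    (ι : W →L[ℂ] V) (q : V →L[ℂ] Q) (j : Q →L[ℂ] V) : Prop where
  norm_ι : ∀ w, ‖ι w‖ = ‖w‖
  norm_q : ∀ v, ‖q v‖ ≤ ‖v‖
  norm_j : ∀ c, ‖j c‖ ≤ ‖c‖
  q_j : ∀ c, q (j c) = c
  q_ι : ∀ w, q (ι w) = 0
  exists_of_q_eq_zero : ∀ v, q v = 0 → ∃ w, ι w = v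
  comm_ι : ∀ k w, T k (ι w) = ι (B k w)
  comm_q : ∀ k v, q (T k v) = C k (q v)

/-- An adapted norm-like function for a family with `‖L(x,n)‖ ≤ K S ^ n`. -/
lemma exists_adapted [Nonempty (Fin ℓ)] {T : Fin ℓ → V →L[ℂ] V} {K S : ℝ} (hS : 0 < S)
    (h : ∀ n x, ‖prodAlong T x n‖ ≤ K * S ^ n) :
    ∃ p : V → ℝ, (∀ v, ‖v‖ ≤ p v) ∧ (∀ v, p v ≤ K * ‖v‖) ∧ ∀ k v, p (T k v) ≤ S * p v := by
  have hle : ∀ v (a : ℕ × (ℕ → Fin ℓ)), ‖prodAlong T a.2 a.1 v‖ / S ^ a.1 ≤ K * ‖v‖ := by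
    intro v a
    rw [div_le_iff₀ (by positivity)]
    refine ((prodAlong T a.2 a.1).le_opNorm v).trans ?_
    calc _ ≤ K * S ^ a.1 * ‖v‖ := by gcongr; exact h _ _
      _ = _ := by ring
  have hbdd : ∀ v, BddAbove (Set.range fun a : ℕ × (ℕ → Fin ℓ) =>
      ‖prodAlong T a.2 a.1 v‖ / S ^ a.1) := fun v => ⟨K * ‖v‖, by
    rintro _ ⟨a, rfl⟩
    exact hle v a⟩
  refine ⟨fun v => ⨆ a : ℕ × (ℕ → Fin ℓ), ‖prodAlong T a.2 a.1 v‖ / S ^ a.1, fun v => ?_,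
    fun v => ciSup_le (hle v), fun k v => ciSup_le fun a => ?_⟩
  · have := le_ciSup (hbdd v) (0, fun _ => Classical.arbitrary _)
    simpa using this
  · have := le_ciSup (hbdd v) (a.1 + 1, cons k a.2)
    simp only [prodAlong_cons] at this
    rw [div_le_iff₀ (by positivity)] at this ⊢
    refine (le_of_eq ?_).trans (this.trans_eq (by ring))
    rfl

lemma exists_uniform_bound (T : Fin ℓ → V →L[ℂ] V) : ∃ D, 0 < D ∧ ∀ k, ‖T k‖ ≤ D := by
  refine ⟨1 + ∑ k, ‖T k‖, ?_, fun k => ?_⟩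
  · have : 0 ≤ ∑ k, ‖T k‖ := Finset.sum_nonneg fun _ _ => norm_nonneg _
    linarith
  · have := Finset.single_le_sum (f := fun k => ‖T k‖) (fun _ _ => norm_nonneg _)
      (Finset.mem_univ k)
    linarith

variable {T : Fin ℓ → V →L[ℂ] V} {B : Fin ℓ → W →L[ℂ] W} {C : Fin ℓ → Q →L[ℂ] Q}
  {ι : W →L[ℂ] V} {q : V →L[ℂ] Q} {j : Q →L[ℂ] V}

lemma IsSplitting.smul (h : IsSplitting T B C ι q j) (a : Fin ℓ → ℂ) :
    IsSplitting (fun k => a k • T k) (fun k => a k • B k) (fun k => a k • C k) ι q j :=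
  { h with
    comm_ι := fun k w => by simp [h.comm_ι]
    comm_q := fun k v => by simp [h.comm_q] }

lemma IsSplitting.prodAlong_ι (h : IsSplitting T B C ι q j) (x : ℕ → Fin ℓ) (n : ℕ) (w : W) :
    prodAlong T x n (ι w) = ι (prodAlong B x n w) := by
  induction n with
  | zero => rfl
  | succ n ih => rw [prodAlong_succ_apply, prodAlong_succ_apply, ih, h.comm_ι]

lemma IsSplitting.q_prodAlong (h : IsSplitting T B C ι q j) (x : ℕ → Fin ℓ) (n : ℕ) (v : V) :
    q (prodAlong T x n v) = prodAlong C x n (q v) := by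
  induction n with
  | zero => rfl
  | succ n ih => rw [prodAlong_succ_apply, prodAlong_succ_apply, h.comm_q, ih]

lemma IsSplitting.norm_left_le (h : IsSplitting T B C ι q j) (x : ℕ → Fin ℓ) (n : ℕ) :
    ‖prodAlong B x n‖ ≤ ‖prodAlong T x n‖ := by
  refine ContinuousLinearMap.opNorm_le_bound _ (norm_nonneg _) fun w => ?_
  rw [← h.norm_ι, ← h.prodAlong_ι, ← h.norm_ι w]
  exact (prodAlong T x n).le_opNorm _

lemma IsSplitting.norm_right_le (h : IsSplitting T B C ι q j) (x : ℕ → Fin ℓ) (n : ℕ) :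
    ‖prodAlong C x n‖ ≤ ‖prodAlong T x n‖ := by
  refine ContinuousLinearMap.opNorm_le_bound _ (norm_nonneg _) fun c => ?_
  calc _ = ‖q (prodAlong T x n (j c))‖ := by rw [h.q_prodAlong, h.q_j]
    _ ≤ ‖prodAlong T x n (j c)‖ := h.norm_q _
    _ ≤ ‖prodAlong T x n‖ * ‖j c‖ := (prodAlong T x n).le_opNorm _
    _ ≤ _ := by gcongr; exact h.norm_j c

/-- Each diagonal block is dominated by the whole product. Conversely, the off-diagonal part is a
sum over the time of passage from the quotient to the subspace, and any rate `S` above both block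
rates absorbs this sum. -/
lemma IsSplitting.isGrowthRate [Nonempty (Fin ℓ)] (h : IsSplitting T B C ι q j) {R₁ R₂ : ℝ}
    (h₁ : IsGrowthRate (fun n x => ‖prodAlong B x n‖) R₁)
    (h₂ : IsGrowthRate (fun n x => ‖prodAlong C x n‖) R₂) :
    IsGrowthRate (fun n x => ‖prodAlong T x n‖) (max R₁ R₂) where
  nonneg := le_max_of_le_left h₁.nonneg
  exists_le n hn := by
    rcases le_total R₁ R₂ with hle | hle
    · rw [max_eq_right hle]
      obtain ⟨x, hx⟩ := h₂.exists_le n hn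
      exact ⟨x, hx.trans (h.norm_right_le x n)⟩
    · rw [max_eq_left hle]
      obtain ⟨x, hx⟩ := h₁.exists_le n hn
      exact ⟨x, hx.trans (h.norm_left_le x n)⟩
  le S hS := by
    obtain ⟨s, hs1, hs2⟩ := exists_between hS
    obtain ⟨K₁, hK₁0, hK₁⟩ := h₁.le s ((le_max_left _ _).trans_lt hs1)
    obtain ⟨K₂, hK₂0, hK₂⟩ := h₂.le s ((le_max_right _ _).trans_lt hs1)
    have hs0 : 0 < s := (le_max_of_le_left h₁.nonneg).trans_lt hs1
    have hS0 : 0 < S := hs0.trans hs2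
    obtain ⟨p, hp1, hp2, hp3⟩ := exists_adapted hs0 hK₂
    obtain ⟨D₁, hD₁0, hD₁⟩ := exists_uniform_bound T
    obtain ⟨D₂, hD₂0, hD₂⟩ := exists_uniform_bound C
    have hp0 : ∀ c, 0 ≤ p c := fun c => (norm_nonneg c).trans (hp1 c)
    -- The least constant at least one with `M * s + K₁ * (D₁ + D₂) ≤ M * S`, which closes the
    -- induction in `hj`.
    set M := max 1 (K₁ * (D₁ + D₂) / (S - s)) with hM
    have hM1 : 1 ≤ M := le_max_left _ _
    have hM2 : K₁ * (D₁ + D₂) ≤ M * (S - s) := by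
      rw [← div_le_iff₀ (by linarith)]; exact le_max_right _ _
    have hι : ∀ x n w, ‖prodAlong T x n (ι w)‖ ≤ K₁ * s ^ n * ‖ι w‖ := fun x n w => by
      rw [h.prodAlong_ι, h.norm_ι, h.norm_ι]
      exact ((prodAlong B x n).le_opNorm w).trans (by gcongr; exact hK₁ n x)
    have hj : ∀ n x c, ‖prodAlong T x n (j c)‖ ≤ M * S ^ n * p c := by
      intro n
      induction n with
      | zero =>
        intro x c
        simp only [prodAlong_zero, pow_zero, mul_one]
        calc ‖j c‖ ≤ 1 * p c := by rw [one_mul]; exact (h.norm_j c).trans (hp1 c)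
          _ ≤ M * p c := by gcongr; exact hp0 c
      | succ n ih =>
        intro x c
        obtain ⟨w, hw⟩ := h.exists_of_q_eq_zero (T (x 0) (j c) - j (C (x 0) c))
          (by rw [map_sub, h.comm_q, h.q_j, h.q_j, sub_self])
        have e : T (x 0) (j c) = j (C (x 0) c) + ι w := by rw [hw]; abel
        have hw' : ‖ι w‖ ≤ (D₁ + D₂) * p c := by
          rw [hw]
          calc _ ≤ ‖T (x 0) (j c)‖ + ‖j (C (x 0) c)‖ := norm_sub_le _ _
            _ ≤ D₁ * ‖c‖ + D₂ * ‖c‖ := by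
              gcongr
              · exact ((T (x 0)).le_opNorm _).trans
                  (mul_le_mul (hD₁ _) (h.norm_j c) (norm_nonneg _) hD₁0.le)
              · exact (h.norm_j _).trans (((C (x 0)).le_opNorm _).trans (by gcongr; exact hD₂ _))
            _ ≤ (D₁ + D₂) * p c := by rw [← add_mul]; gcongr; exact hp1 c
        rw [prodAlong_succ_apply', e, map_add]
        calc _ ≤ ‖prodAlong T (shift x) n (j (C (x 0) c))‖ + ‖prodAlong T (shift x) n (ι w)‖ :=
              norm_add_le _ _
          _ ≤ M * S ^ n * (s * p c) + K₁ * S ^ n * ((D₁ + D₂) * p c) := by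
            gcongr
            · exact (ih _ _).trans (by gcongr; exact hp3 _ _)
            · exact (hι _ _ _).trans (by gcongr)
          _ = S ^ n * p c * (M * s + K₁ * (D₁ + D₂)) := by ring
          _ ≤ S ^ n * p c * (M * S) := by
            have := hp0 c
            gcongr
            linarith
          _ = _ := by ring
    refine ⟨M * K₂ + 2 * K₁, by positivity, fun n x => ?_⟩
    refine ContinuousLinearMap.opNorm_le_bound _ (by positivity) fun v => ?_
    obtain ⟨w, hw⟩ := h.exists_of_q_eq_zero (v - j (q v)) (by rw [map_sub, h.q_j, sub_self])
    have e : v = j (q v) + ι w := by rw [hw]; abel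
    have hjq : ‖j (q v)‖ ≤ ‖v‖ := (h.norm_j _).trans (h.norm_q v)
    have hw' : ‖ι w‖ ≤ 2 * ‖v‖ := by
      rw [hw]
      exact (norm_sub_le _ _).trans (by linarith)
    calc ‖prodAlong T x n v‖ = ‖prodAlong T x n (j (q v)) + prodAlong T x n (ι w)‖ := by
          rw [← map_add, ← e]
      _ ≤ ‖prodAlong T x n (j (q v))‖ + ‖prodAlong T x n (ι w)‖ := norm_add_le _ _
      _ ≤ M * S ^ n * (K₂ * ‖v‖) + K₁ * S ^ n * (2 * ‖v‖) := by
        gcongr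
        · exact (hj _ _ _).trans (by
            gcongr
            exact (hp2 _).trans (by gcongr; exact h.norm_q v))
        · exact (hι _ _ _).trans (by gcongr)
      _ = _ := by ring

/-- If `z` were not an eigenvalue upstairs, `z - L` would be surjective in finite dimension, hence
surjective and so injective on the quotient. -/
lemma IsSplitting.exists_eigenvector [FiniteDimensional ℂ V] [FiniteDimensional ℂ Q]
    (h : IsSplitting T B C ι q j) (x : ℕ → Fin ℓ) (n : ℕ) {z : ℂ} {c : Q} (hc0 : c ≠ 0)
    (hc : prodAlong C x n c = z • c) : ∃ v : V, v ≠ 0 ∧ prodAlong T x n v = z • v := by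
  by_contra! hcon
  set f : V →ₗ[ℂ] V := z • LinearMap.id - ((prodAlong T x n : V →L[ℂ] V) : V →ₗ[ℂ] V) with hf
  set g : Q →ₗ[ℂ] Q := z • LinearMap.id - ((prodAlong C x n : Q →L[ℂ] Q) : Q →ₗ[ℂ] Q) with hg
  have hfi : Function.Injective f := by
    refine (injective_iff_map_eq_zero f).2 fun v hv => ?_
    by_contra hv0
    refine hcon v hv0 ?_
    simp only [hf, LinearMap.sub_apply, LinearMap.smul_apply, LinearMap.id_apply,
      ContinuousLinearMap.coe_coe, sub_eq_zero] at hv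
    exact hv.symm
  have hfs := LinearMap.injective_iff_surjective.1 hfi
  have hgs : Function.Surjective g := fun c' => by
    obtain ⟨v, hv⟩ := hfs (j c')
    refine ⟨q v, ?_⟩
    rw [← h.q_j c', ← hv]
    simp [hf, hg, h.q_prodAlong]
  have hgi := LinearMap.injective_iff_surjective.2 hgs
  refine hc0 (hgi (a₁ := c) (a₂ := 0) ?_)
  simp [hg, hc]

end Splitting

/-! ### Common invariant subspaces and reduction of dimension -/

section Invariant

variable {ℓ : ℕ} {V : Type*} [NormedAddCommGroup V]

/-- If the products are not bounded by multiples of `R ^ n`, there is a proper nontrivial common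
invariant subspace. -/
lemma exists_invariant [NormedSpace ℂ V] [FiniteDimensional ℂ V] [Nonempty (Fin ℓ)]
    {T : Fin ℓ → V →L[ℂ] V} {R : ℝ}
    (hR0 : 0 < R) (hR : IsGrowthRate (fun n x => ‖prodAlong T x n‖) R)
    (hunb : ¬ ∃ C, ∀ n x, ‖prodAlong T x n‖ ≤ C * R ^ n) :
    ∃ W : Submodule ℂ V, W ≠ ⊥ ∧ W ≠ ⊤ ∧ ∀ k, ∀ w ∈ W, T k w ∈ W := by
  have : ProperSpace V := FiniteDimensional.proper ℂ V
  have : CompleteSpace V := FiniteDimensional.complete ℂ V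
  -- The vectors whose orbits are `O(R ^ n)`. If `W = ⊤`, uniform boundedness contradicts `hunb`;
  -- the case `W = ⊥` will contradict the growth rate.
  let W : Submodule ℂ V :=
    { carrier := {v | ∃ C, ∀ n x, ‖prodAlong T x n v‖ ≤ C * R ^ n}
      zero_mem' := ⟨0, by simp⟩
      add_mem' := by
        rintro v w ⟨C, hC⟩ ⟨D, hD⟩
        refine ⟨C + D, fun n x => ?_⟩
        rw [map_add, add_mul]
        exact (norm_add_le _ _).trans (add_le_add (hC n x) (hD n x))
      smul_mem' := by
        rintro a v ⟨C, hC⟩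
        refine ⟨‖a‖ * C, fun n x => ?_⟩
        rw [map_smul, norm_smul, mul_assoc]
        gcongr
        exact hC n x }
  refine ⟨W, fun hbot => ?_, fun htop => hunb ?_, fun k w hw => ?_⟩
  · have hex : ∀ v ∈ Metric.sphere (0 : V) 1, ∃ n x, 2 * R ^ n < ‖prodAlong T x n v‖ := by
      intro v hv
      by_contra! hcon
      have : v ∈ W := ⟨2, hcon⟩
      rw [hbot, Submodule.mem_bot] at this
      rw [this] at hv
      simp at hv
    let O : ℕ → Set V := fun M => {v | ∃ n ≤ M, ∃ x, 2 * R ^ n < ‖prodAlong T x n v‖}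
    have hO : ∀ M, IsOpen (O M) := fun M => by
      have : O M = ⋃ n, ⋃ _ : n ≤ M, ⋃ x, {v | 2 * R ^ n < ‖prodAlong T x n v‖} := by
        ext v; simp [O]
      rw [this]
      exact isOpen_iUnion fun n => isOpen_iUnion fun _ => isOpen_iUnion fun x =>
        isOpen_lt continuous_const (prodAlong T x n).continuous.norm
    obtain ⟨M, hM⟩ := (isCompact_sphere (0 : V) 1).elim_directed_cover O hO
      (fun v hv => by
        obtain ⟨n, x, h⟩ := hex v hv
        exact Set.mem_iUnion.2 ⟨n, n, le_rfl, x, h⟩)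
      (monotone_nat_of_le_succ fun M v => by
        rintro ⟨n, hn, x, h⟩
        exact ⟨n, by omega, x, h⟩).directed_le
    -- By compactness the growth past `2 * R ^ n` happens by time `M`. With `S` this close to `R`,
    -- such a vector still gains a factor `2 / (4 / 3) = 3 / 2` relative to `S ^ n`.
    obtain ⟨S, hSM, hRS⟩ : ∃ S, (S / R) ^ M < 4 / 3 ∧ R < S := by
      have hc : Tendsto (fun S => (S / R) ^ M) (𝓝[>] R) (𝓝 ((R / R) ^ M)) :=
        (((continuous_id.div_const R).pow M).tendsto R).mono_left nhdsWithin_le_nhds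
      rw [div_self hR0.ne', one_pow] at hc
      exact ((hc.eventually_lt_const (by norm_num : (1 : ℝ) < 4 / 3)).and
        (eventually_mem_nhdsWithin (s := Set.Ioi R))).exists
    have hS0 := hR0.trans hRS
    obtain ⟨K, hK0, hK⟩ := hR.le S hRS
    obtain ⟨p, hp1, hp2, hp3⟩ := exists_adapted hS0 hK
    have hpn : ∀ n x v, p (prodAlong T x n v) ≤ S ^ n * p v := by
      intro n x v
      induction n with
      | zero => simp
      | succ n ih =>
        rw [prodAlong_succ_apply, pow_succ', mul_assoc]
        exact (hp3 _ _).trans (by gcongr)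
    have hgrow : ∀ v : V, v ≠ 0 → ∃ n x, 3 / 2 * S ^ n * ‖v‖ ≤ ‖prodAlong T x n v‖ := by
      intro v hv
      have hv0 : 0 < ‖v‖ := norm_pos_iff.2 hv
      obtain ⟨n, hn, x, hlt⟩ := hM (show ((‖v‖⁻¹ : ℝ) : ℂ) • v ∈ Metric.sphere (0 : V) 1 by
        simp [norm_smul, hv0.ne'])
      refine ⟨n, x, ?_⟩
      rw [map_smul, norm_smul, Complex.norm_real, norm_inv, norm_norm, inv_mul_eq_div,
        lt_div_iff₀ hv0] at hlt
      refine le_trans ?_ hlt.le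
      have h1 : (S / R) ^ n ≤ 4 / 3 :=
        (pow_le_pow_right₀ ((one_le_div hR0).2 hRS.le) hn).trans hSM.le
      rw [div_pow, div_le_iff₀ (by positivity)] at h1
      exact mul_le_mul_of_nonneg_right (by linarith) hv0.le
    -- Iterating the gain makes the adapted `p` exceed every multiple of the norm, against `hp2`.
    have hall : ∀ m : ℕ, ∀ v, (3 / 2 : ℝ) ^ m * ‖v‖ ≤ p v := by
      intro m
      induction m with
      | zero => intro v; simpa using hp1 v
      | succ m ih =>
        intro v
        rcases eq_or_ne v 0 with rfl | hv
        · simpa using hp1 0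
        obtain ⟨n, x, h⟩ := hgrow v hv
        have h2 := (ih _).trans (hpn n x v)
        have h3 := (mul_le_mul_of_nonneg_left h (by positivity : (0 : ℝ) ≤ (3 / 2) ^ m)).trans h2
        refine le_of_mul_le_mul_left (le_trans (le_of_eq ?_) h3) (by positivity : 0 < S ^ n)
        ring
    have hVn : ∃ v : V, v ≠ 0 := by
      by_contra! hcon
      refine hunb ⟨0, fun n x => ?_⟩
      have : prodAlong T x n = 0 := by ext v; rw [hcon v]; simp
      simp [this]
    obtain ⟨v, hv⟩ := hVn
    have hv0 : 0 < ‖v‖ := norm_pos_iff.2 hv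
    obtain ⟨m, hm⟩ := pow_unbounded_of_one_lt K (by norm_num : (1 : ℝ) < 3 / 2)
    have := (hall m v).trans (hp2 v)
    exact absurd (le_of_mul_le_mul_right this hv0) (not_le.2 hm)
  · obtain ⟨C, hC⟩ := banach_steinhaus
      (g := fun a : ℕ × (ℕ → Fin ℓ) => (((R ^ a.1)⁻¹ : ℝ) : ℂ) • prodAlong T a.2 a.1)
      (fun v => by
        obtain ⟨C, hC⟩ : v ∈ W := by rw [htop]; trivial
        refine ⟨C, fun a => ?_⟩
        rw [smul_apply, norm_smul, Complex.norm_real, norm_inv,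
          Real.norm_of_nonneg (by positivity), inv_mul_eq_div, div_le_iff₀ (by positivity)]
        exact hC _ _)
    refine ⟨C, fun n x => ?_⟩
    have := hC (n, x)
    rwa [norm_smul, Complex.norm_real, norm_inv, Real.norm_of_nonneg (by positivity),
      inv_mul_eq_div, div_le_iff₀ (by positivity)] at this
  · obtain ⟨C, hC⟩ := hw
    refine ⟨C * R, fun n x => ?_⟩
    have := hC (n + 1) (cons k x)
    rw [prodAlong_cons] at this
    exact this.trans_eq (by ring)

/-- The orthogonal complement models the quotient, so the projection and its section both have norm
at most one. -/
lemma exists_isSplitting [InnerProductSpace ℂ V] [FiniteDimensional ℂ V]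
    {T : Fin ℓ → V →L[ℂ] V} {W : Submodule ℂ V} (hW : ∀ k, ∀ w ∈ W, T k w ∈ W) :
    ∃ (B : Fin ℓ → W →L[ℂ] W) (C : Fin ℓ → Wᗮ →L[ℂ] Wᗮ) (ι : W →L[ℂ] V) (q : V →L[ℂ] Wᗮ)
      (j : Wᗮ →L[ℂ] V), IsSplitting T B C ι q j := by
  have hz : ∀ v, (Wᗮ).orthogonalProjectionOnto v = 0 ↔ v ∈ W := fun v => by
    rw [Submodule.orthogonalProjectionOnto_eq_zero_iff, Submodule.orthogonal_orthogonal]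
  refine ⟨fun k => ((T k).comp W.subtypeL).codRestrict W fun w => hW k w w.2,
    fun k => (Wᗮ).orthogonalProjectionOnto.comp ((T k).comp (Wᗮ).subtypeL), W.subtypeL,
    (Wᗮ).orthogonalProjectionOnto, (Wᗮ).subtypeL, ?_⟩
  refine ⟨fun _ => rfl, fun v => Submodule.norm_orthogonalProjectionOnto_apply_le _ v,
    fun _ => le_rfl, fun c => Submodule.orthogonalProjectionOnto_mem_subspace_eq_self c,
    fun w => (hz _).2 w.2, fun v hv => ⟨⟨v, (hz v).1 hv⟩, rfl⟩, fun _ _ => rfl, fun k v => ?_⟩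
  rw [← sub_eq_zero]
  simp only [ContinuousLinearMap.comp_apply]
  rw [← map_sub, hz, ← map_sub]
  refine hW k _ ?_
  rw [← hz, map_sub, sub_eq_zero]
  exact (Submodule.orthogonalProjectionOnto_mem_subspace_eq_self _).symm

lemma finrank_lt_of_ne [InnerProductSpace ℂ V] [FiniteDimensional ℂ V] {W : Submodule ℂ V}
    (hbot : W ≠ ⊥) (htop : W ≠ ⊤) : Module.finrank ℂ W < Module.finrank ℂ V ∧
      Module.finrank ℂ Wᗮ < Module.finrank ℂ V :=
  ⟨Submodule.finrank_lt htop, Submodule.finrank_lt fun h =>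
    hbot ((Submodule.orthogonal_eq_top_iff _).1 h)⟩

end Invariant

/-! ### Eigenvalues of products and lower semicontinuity of the growth rate -/

section Eigenvalue

variable {V : Type*} [NormedAddCommGroup V] [NormedSpace ℂ V] [FiniteDimensional ℂ V]

/-- If all eigenvalues of `f` have modulus at most `r ≤ ‖w‖`, then
`|det (w - f)| ≥ (‖w‖ - r) ^ dim V`. -/
lemma pow_le_norm_det (f : V →L[ℂ] V) (w : ℂ) {r : ℝ} (hr : r ≤ ‖w‖)
    (h : ∀ (z : ℂ) (v : V), v ≠ 0 → f v = z • v → ‖z‖ ≤ r) :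
    (‖w‖ - r) ^ Module.finrank ℂ V ≤ ‖(w • (1 : V →L[ℂ] V) - f).det‖ := by
  set g := (f : V →ₗ[ℂ] V) with hg
  have e : (w • (1 : V →L[ℂ] V) - f).det = g.charpoly.eval w := by
    rw [LinearMap.eval_charpoly]
    rfl
  have hs := IsAlgClosed.splits g.charpoly
  have hroots : ∀ z ∈ g.charpoly.roots, ‖w‖ - r ≤ ‖w - z‖ := by
    intro z hz
    have h1 : Module.End.HasEigenvalue g z :=
      (Module.End.hasEigenvalue_iff_isRoot_charpoly g z).2 (Polynomial.isRoot_of_mem_roots hz)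
    obtain ⟨v, hv⟩ := h1.exists_hasEigenvector
    have := h z v hv.2 hv.apply_eq_smul
    linarith [norm_sub_norm_le w z]
  rw [e, hs.eval_eq_prod_roots, (LinearMap.charpoly_monic g).leadingCoeff, one_mul,
    ← LinearMap.charpoly_natDegree g, hs.natDegree_eq_card_roots]
  generalize g.charpoly.roots = m at hroots
  induction m using Multiset.induction_on with
  | empty => simp
  | cons a m ih =>
    rw [Multiset.map_cons, Multiset.prod_cons, Multiset.card_cons, pow_succ', norm_mul]
    have : 0 ≤ ‖w‖ - r := by linarith
    gcongr
    · exact hroots a (Multiset.mem_cons_self a m)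
    · exact ih fun z hz => hroots z (Multiset.mem_cons_of_mem hz)

lemma det_ne_zero_of_forall {f : V →L[ℂ] V} (h : f.det ≠ 0) {v : V} (hv : f v = 0) : v = 0 := by
  by_contra hv0
  exact h ((LinearMap.det_eq_zero_iff_ker_ne_bot).2
    fun hk => hv0 ((Submodule.mem_bot ℂ).1 (hk ▸ (LinearMap.mem_ker.2 hv))))

/-- An operator with an approximate fixed vector has an eigenvalue of modulus almost one. -/
lemma exists_eigenvalue_of_approx (C : ℝ) {c η : ℝ} (hc : 0 < c) (hη0 : 0 < η) :
    ∃ ε, 0 < ε ∧ ∀ (P : V →L[ℂ] V) (v : V), ‖P‖ ≤ C → c ≤ ‖v‖ → ‖P v - v‖ ≤ ε →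
      ∃ (z : ℂ) (u : V), u ≠ 0 ∧ P u = z • u ∧ 1 - η < ‖z‖ := by
  have : ProperSpace V := FiniteDimensional.proper ℂ V
  have : ProperSpace (V →L[ℂ] V) := FiniteDimensional.proper ℂ _
  have hdet : Continuous fun P : V →L[ℂ] V => ‖((1 : ℂ) • (1 : V →L[ℂ] V) - P).det‖ :=
    (ContinuousLinearMap.continuous_det.comp (continuous_const.sub continuous_id)).norm
  -- By `pow_le_norm_det`, every `P` in the ball whose eigenvalues have modulus at most `1 - η` lies
  -- in `K`. On `K` the operator `1 - P` is invertible, and compactness bounds it below on unit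
  -- vectors.
  let K : Set (V →L[ℂ] V) := Metric.closedBall 0 C ∩
    {P | η ^ Module.finrank ℂ V ≤ ‖((1 : ℂ) • (1 : V →L[ℂ] V) - P).det‖}
  have hK : IsCompact K := (isCompact_closedBall _ _).inter_right (isClosed_le continuous_const hdet)
  obtain ⟨m, hm0, hm⟩ := (hK.prod (isCompact_sphere (0 : V) 1)).exists_forall_le'
    (f := fun a : (V →L[ℂ] V) × V => ‖a.1 a.2 - a.2‖) (a := 0)
    ((continuous_fst.clm_apply continuous_snd).sub continuous_snd).norm.continuousOn
    (by
      rintro ⟨P, u⟩ ⟨⟨-, hP⟩, hu⟩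
      refine norm_pos_iff.2 fun h0 => ?_
      have hd : ((1 : ℂ) • (1 : V →L[ℂ] V) - P).det ≠ 0 :=
        norm_pos_iff.1 ((by positivity : 0 < η ^ Module.finrank ℂ V).trans_le hP)
      have hu0 : u = 0 := det_ne_zero_of_forall hd (by
        have : P u = u := sub_eq_zero.1 h0
        simp [this])
      rw [hu0] at hu
      simp at hu)
  refine ⟨m * c / 2, by positivity, fun P v hP hv hPv => ?_⟩
  by_contra! hcon
  have hPK : P ∈ K := by
    refine ⟨by simpa using hP, ?_⟩
    have := pow_le_norm_det P 1 (r := 1 - η) (by simp; linarith) hcon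
    simpa using this
  have hv0 : 0 < ‖v‖ := hc.trans_le hv
  have h1 := hm (P, ((‖v‖⁻¹ : ℝ) : ℂ) • v) ⟨hPK, by simp [norm_smul, hv0.ne']⟩
  simp only [map_smul] at h1
  rw [← smul_sub, norm_smul, Complex.norm_real, norm_inv, norm_norm, inv_mul_eq_div,
    le_div_iff₀ hv0] at h1
  have h2 : m * c ≤ m * ‖v‖ := by gcongr
  have : 0 < m * c := by positivity
  linarith

/-- Along a strongly extremal sequence the normalised products stay in a compact set, away from
zero. Two of them nearly coincide, so the normalised product between those times nearly fixes a
vector of definite size and has an eigenvalue close to the unit circle or outside it. -/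
lemma exists_eigenvalue_of_bounded {ℓ : ℕ} {T : Fin ℓ → V →L[ℂ] V} {R C : ℝ} (hR0 : 0 < R)
    (hR : IsGrowthRate (fun n x => ‖prodAlong T x n‖) R)
    (hC : ∀ n x, ‖prodAlong T x n‖ ≤ C * R ^ n) {s : ℝ} (hs0 : 0 ≤ s) (hs : s < R) :
    ∃ (x : ℕ → Fin ℓ) (n : ℕ) (z : ℂ) (v : V), 1 ≤ n ∧ v ≠ 0 ∧ prodAlong T x n v = z • v ∧
      s ^ n < ‖z‖ := by
  have hN := isCocycle_norm_prodAlong T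
  obtain ⟨μ, -, hμ⟩ := hN.exists_isMax hR
  obtain ⟨x, ε₀, hε₀, hx⟩ := ((hμ hR0).ae_exists_le hN hR0 (le_max_right C 1) fun n x =>
    (hC n x).trans (by gcongr; exact le_max_left _ _)).exists
  obtain ⟨ε, hε0, hε⟩ := exists_eigenvalue_of_approx (V := V) C (c := ε₀ / 2) (η := 1 - s / R)
    (by positivity) (by rw [sub_pos, div_lt_one hR0]; exact hs)
  have : ProperSpace (V →L[ℂ] V) := FiniteDimensional.proper ℂ _
  have hnorm : ∀ (n : ℕ) (P : V →L[ℂ] V), ‖(((R ^ n)⁻¹ : ℝ) : ℂ) • P‖ = ‖P‖ / R ^ n :=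
    fun n P => by
      rw [norm_smul, Complex.norm_real, norm_inv, Real.norm_of_nonneg (by positivity),
        inv_mul_eq_div]
  let L : ℕ → V →L[ℂ] V := fun n => (((R ^ (n + 1))⁻¹ : ℝ) : ℂ) • prodAlong T x (n + 1)
  obtain ⟨P₀, -, φ, hφ, hlim⟩ := (isCompact_closedBall (0 : V →L[ℂ] V) C).tendsto_subseq
    (x := L) fun n => by
      simp only [L, mem_closedBall_zero_iff]
      rw [hnorm, div_le_iff₀ (by positivity)]
      exact hC _ _
  obtain ⟨k, hk⟩ := Metric.cauchySeq_iff.1 hlim.cauchySeq ε hε0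
  -- Consecutive terms of the subsequence are strictly separated in time, so the intermediate
  -- product has positive length `m + 1`.
  have hlt := hφ (Nat.lt_succ_self k)
  have hd := hk (k + 1) (by omega) k le_rfl
  obtain ⟨m, hm⟩ := Nat.exists_eq_add_of_lt hlt
  simp only [Function.comp_apply, dist_eq_norm] at hd
  rw [Nat.succ_eq_add_one] at hm
  rw [hm] at hd
  set i := φ k with hi
  obtain ⟨u, hu1, hu⟩ := ContinuousLinearMap.exists_lt_apply_of_lt_opNorm (L i) (r := ε₀ / 2) (by
    have := hx (i + 1) (by omega)
    rw [← le_div_iff₀ (by positivity)] at this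
    simp only [L, hnorm]
    linarith)
  obtain ⟨z, v, hv0, hv, hz⟩ := hε
    ((((R ^ (m + 1))⁻¹ : ℝ) : ℂ) • prodAlong T (shift^[i + 1] x) (m + 1)) (L i u)
    (by
      rw [hnorm, div_le_iff₀ (by positivity)]
      exact hC _ _) hu.le
    (by
      have e : ((((R ^ (m + 1))⁻¹ : ℝ) : ℂ) • prodAlong T (shift^[i + 1] x) (m + 1)) (L i u) =
          L (i + m + 1) u := by
        have e2 : i + m + 1 + 1 = (i + 1) + (m + 1) := by ring
        simp only [L, smul_apply, map_smul]
        rw [e2, prodAlong_add_apply T x (i + 1) (m + 1), smul_smul, ← Complex.ofReal_mul, ← mul_inv, ← pow_add]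
      rw [e, ← sub_apply]
      calc _ ≤ ‖L (i + m + 1) - L i‖ * ‖u‖ := ContinuousLinearMap.le_opNorm _ _
        _ ≤ ε * 1 := by gcongr
        _ = ε := mul_one ε)
  have hRm : (((R ^ (m + 1) : ℝ)) : ℂ) ≠ 0 := by
    exact_mod_cast (pow_pos hR0 (m + 1)).ne'
  refine ⟨shift^[i + 1] x, m + 1, ((R ^ (m + 1) : ℝ) : ℂ) * z, v, by omega, hv0, ?_, ?_⟩
  · rw [mul_smul, ← hv, smul_apply, smul_smul, Complex.ofReal_inv, mul_inv_cancel₀ hRm, one_smul]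
  · rw [norm_mul, Complex.norm_real, Real.norm_of_nonneg (by positivity)]
    rw [sub_sub_cancel] at hz
    calc s ^ (m + 1) = s ^ m * s := pow_succ s m
      _ ≤ R ^ m * s := by gcongr
      _ = R ^ (m + 1) * (s / R) := by rw [pow_succ]; field_simp
      _ < _ := by gcongr

end Eigenvalue

/-! ### Berger-Wang approximation and semicontinuity of the growth rate -/

section BergerWang

variable {ℓ : ℕ} [Nonempty (Fin ℓ)]

/-- The growth rate of a finite family of operators is approximated by the eigenvalues of
products. -/
theorem exists_eigenvalue_of_lt {V : Type*} [NormedAddCommGroup V] [InnerProductSpace ℂ V]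
    [FiniteDimensional ℂ V] {T : Fin ℓ → V →L[ℂ] V} {R : ℝ}
    (hR : IsGrowthRate (fun n x => ‖prodAlong T x n‖) R) {s : ℝ} (hs0 : 0 ≤ s) (hs : s < R) :
    ∃ (x : ℕ → Fin ℓ) (n : ℕ) (z : ℂ) (v : V), 1 ≤ n ∧ v ≠ 0 ∧ prodAlong T x n v = z • v ∧
      s ^ n < ‖z‖ := by
  induction hd : Module.finrank ℂ V using Nat.strong_induction_on generalizing V with
  | _ d ih =>
    have hR0 : 0 < R := hs0.trans_lt hs
    by_cases hb : ∃ C, ∀ n x, ‖prodAlong T x n‖ ≤ C * R ^ n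
    · obtain ⟨C, hC⟩ := hb
      exact exists_eigenvalue_of_bounded hR0 hR hC hs0 hs
    obtain ⟨W, hbot, htop, hW⟩ := exists_invariant hR0 hR hb
    obtain ⟨B, C, ι, q, j, h⟩ := exists_isSplitting hW
    obtain ⟨hd1, hd2⟩ := finrank_lt_of_ne hbot htop
    obtain ⟨R₁, h₁⟩ := (isCocycle_norm_prodAlong B).exists_isGrowthRate
    obtain ⟨R₂, h₂⟩ := (isCocycle_norm_prodAlong C).exists_isGrowthRate
    have hmax := hR.unique (h.isGrowthRate h₁ h₂)
    rcases le_total R₁ R₂ with hle | hle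
    · rw [max_eq_right hle] at hmax
      obtain ⟨x, n, z, c, hn, hc0, hc, hz⟩ := ih _ (hd ▸ hd2) (hmax ▸ h₂) rfl
      obtain ⟨v, hv0, hv⟩ := h.exists_eigenvector x n hc0 hc
      exact ⟨x, n, z, v, hn, hv0, hv, hz⟩
    · rw [max_eq_left hle] at hmax
      obtain ⟨x, n, z, w, hn, hw0, hw, hz⟩ := ih _ (hd ▸ hd1) (hmax ▸ h₁) rfl
      refine ⟨x, n, z, ι w, hn, fun h0 => hw0 ?_, ?_, hz⟩
      · rw [← norm_eq_zero, ← h.norm_ι, h0, norm_zero]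
      · rw [h.prodAlong_ι, hw, map_smul]

/-- Lower semicontinuity of the growth rate. -/
theorem eventually_le_growthRate {V : Type*} [NormedAddCommGroup V] [InnerProductSpace ℂ V]
    [FiniteDimensional ℂ V] {Δ : Type*} [TopologicalSpace Δ] {T : Fin ℓ → Δ → V →L[ℂ] V}
    (hT : ∀ k, Continuous (T k)) {R : Δ → ℝ}
    (hR : ∀ a, IsGrowthRate (fun n x => ‖prodAlong (fun k => T k a) x n‖) (R a)) (a₀ : Δ) {s : ℝ}
    (hs0 : 0 ≤ s) (hs : s < R a₀) : ∀ᶠ a in 𝓝 a₀, s ≤ R a := by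
  obtain ⟨x, n, z, v, hn, hv0, hv, hz⟩ := exists_eigenvalue_of_lt (hR a₀) hs0 hs
  -- This determinant vanishes at `a₀`. Were all eigenvalues at a nearby `a` of modulus at most `s ^
  -- n`, it would be at least `(‖z‖ - s ^ n) ^ dim V`.
  have hcont : Continuous fun a =>
      ‖(z • (1 : V →L[ℂ] V) - prodAlong (fun k => T k a) x n).det‖ :=
    (ContinuousLinearMap.continuous_det.comp (continuous_const.sub
      ((continuous_prodAlong hT n).comp (f := fun a => (a, x)) (by fun_prop)))).norm
  have h0 : (z • (1 : V →L[ℂ] V) - prodAlong (fun k => T k a₀) x n).det = 0 := by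
    by_contra hne
    exact hv0 (det_ne_zero_of_forall hne (by simp [hv]))
  have hlim := hcont.tendsto a₀
  rw [h0, norm_zero] at hlim
  filter_upwards [hlim.eventually_lt_const
    (pow_pos (sub_pos.2 hz) (Module.finrank ℂ V))] with a ha
  obtain ⟨z', v', hv'0, hv', hz'⟩ : ∃ (z' : ℂ) (v' : V), v' ≠ 0 ∧
      prodAlong (fun k => T k a) x n v' = z' • v' ∧ s ^ n < ‖z'‖ := by
    by_contra! hcon
    exact absurd (pow_le_norm_det _ z hz.le hcon) (not_le.2 ha)
  -- Powers of the product are themselves products along a periodic sequence, so the growth rate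
  -- bounds the eigenvalue.
  obtain ⟨y, hy⟩ := exists_prodAlong_eq_pow (fun k => T k a) x n
  refine le_of_forall_gt_imp_ge_of_dense fun S hS => ?_
  have hS0 : 0 < S := (hR a).nonneg.trans_lt hS
  obtain ⟨C, -, hC⟩ := (hR a).le S hS
  have hpow : ∀ q : ℕ, (prodAlong (fun k => T k a) x n ^ q) v' = z' ^ q • v' := by
    intro q
    induction q with
    | zero => simp
    | succ q ih =>
      rw [pow_succ', pow_succ', mul_smul, ← smul_comm, ← hv', ← map_smul, ← ih]
      rfl
  have hle : ‖z'‖ ≤ S ^ n := by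
    refine le_of_forall_pow_le_mul (C := C) (by positivity) fun q _ => ?_
    have h1 := (prodAlong (fun k => T k a) x n ^ q).le_opNorm v'
    rw [hpow q, norm_smul, norm_pow] at h1
    have h2 := le_of_mul_le_mul_right h1 (norm_pos_iff.2 hv'0)
    rw [← hy] at h2
    refine h2.trans ((hC _ _).trans_eq ?_)
    rw [mul_comm q, pow_mul]
  exact (lt_of_pow_lt_pow_left₀ n hS0.le (hz'.trans_le hle)).le

end BergerWang

/-! ### Strongly extremal points of maximising measures -/

section Strong

variable {ℓ : ℕ}

lemma continuous_curry_log_max {Δ X : Type*} [TopologicalSpace Δ] [TopologicalSpace X]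
    {F : Δ → X → ℝ} (hF : Continuous fun a : Δ × X => F a.1 a.2) {δ : ℝ} (hδ : 0 < δ) :
    ∃ G : C(Δ, C(X, ℝ)), ∀ a x, G a x = Real.log (max (F a x) δ) :=
  ⟨ContinuousMap.curry ⟨_, continuous_log_max hF hδ⟩, fun _ _ => rfl⟩

lemma continuous_measureReal_cylinder (i : Fin ℓ) :
    Continuous fun μ : ProbabilityMeasure (ℕ → Fin ℓ) =>
      (μ : Measure (ℕ → Fin ℓ)).real (cylinder i) := by
  have := ProbabilityMeasure.continuous_integral_continuousMap
    (⟨_, continuous_indicator_cylinder i⟩ : C(ℕ → Fin ℓ, ℝ))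
  refine this.congr fun μ => ?_
  simp only [ContinuousMap.coe_mk]
  rw [integral_indicator_const (1 : ℝ) (isClopen_cylinder i).2.measurableSet, smul_eq_mul, mul_one]

/-- Take maximising measures `ν t` of the twisted cocycles and let `t → 0`. Untwisting with the
subgradient inequality gives `s * m ≤ s * ν t ([i])`, and the limit is maximising for `N` because
`log (ρ t)` stays above a quantity tending to `log R`. -/
lemma exists_isMax_of_twist {N : ℕ → (ℕ → Fin ℓ) → ℝ} (hN : IsCocycle N) {i : Fin ℓ}
    {R R₀ s m : ℝ} (hR0 : 0 < R) (hR₀ : IsGrowthRate N R₀) (hle : R₀ ≤ R) {ρ : ℝ → ℝ}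
    (hρ : ∀ t, IsGrowthRate (twist i (t * s) N) (ρ t)) (U : Ultrafilter ℝ)
    (hU : (U : Filter ℝ) ≤ 𝓝[>] 0)
    (h : ∀ᶠ t in (U : Filter ℝ), 0 < ρ t ∧ Real.log R + t * s * m ≤ Real.log (ρ t)) :
    IsGrowthRate N R ∧ ∃ ν ∈ maxSet N R,
      s * m ≤ s * (ν : Measure (ℕ → Fin ℓ)).real (cylinder i) := by
  have hU0 : (U : Filter ℝ) ≤ 𝓝 0 := hU.trans nhdsWithin_le_nhds
  have hpos : ∀ᶠ t in (U : Filter ℝ), 0 < t := hU (eventually_mem_nhdsWithin (s := Set.Ioi 0))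
  have hlimlog : Tendsto (fun t => Real.log R + t * s * m) U (𝓝 (Real.log R + 0 * s * m)) :=
    ((continuous_const.add ((continuous_id.mul continuous_const).mul continuous_const)).tendsto
      0).mono_left hU0
  rw [zero_mul, zero_mul, add_zero] at hlimlog
  have hRR₀ : R = R₀ := by
    refine le_antisymm ?_ hle
    have h1 : Tendsto (fun t => Real.exp |t * s| * R₀) U (𝓝 (Real.exp |0 * s| * R₀)) :=
      ((Real.continuous_exp.comp (continuous_id.mul continuous_const).abs).mul
        continuous_const).tendsto 0 |>.mono_left hU0
    have h2 := (Real.continuous_exp.tendsto _).comp hlimlog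
    rw [Real.exp_log hR0] at h2
    rw [zero_mul, abs_zero, Real.exp_zero, one_mul] at h1
    refine le_of_tendsto_of_tendsto h2 h1 ?_
    filter_upwards [h] with t ht
    have := (Real.le_log_iff_exp_le ht.1).1 ht.2
    exact this.trans (hR₀.twist_le hN (hρ t))
  subst hRR₀
  choose ν hν using fun t => (hN.twist i (t * s)).exists_isMax (hρ t)
  obtain ⟨ν₀, hν₀⟩ := exists_tendsto_of_ultrafilter U ν
  refine ⟨hR₀, ν₀, ⟨measurePreserving_of_tendsto' continuous_shift hν₀
    (Eventually.of_forall fun t => (hν t).1), fun _ n hn δ hδ => ?_⟩, ?_⟩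
  · have hF : Continuous fun a : ℝ × (ℕ → Fin ℓ) => twist i (a.1 * s) N n a.2 :=
      (((continuous_fst.mul continuous_const).mul
        ((continuous_symbolCount i n).comp continuous_snd)).rexp).mul
        ((hN.cont n).comp continuous_snd)
    obtain ⟨G, hG⟩ := continuous_curry_log_max (F := fun t => twist i (t * s) N n) hF hδ
    have h1 := tendsto_integral_of_tendsto hν₀ ((G.continuous.tendsto 0).mono_left hU0)
    simp only [hG, twist, zero_mul, Real.exp_zero, one_mul] at h1
    refine le_of_tendsto_of_tendsto (hlimlog.const_mul (n : ℝ)) h1 ?_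
    filter_upwards [h] with t ht
    refine le_trans ?_ ((hν t).2 ht.1 n hn δ hδ)
    gcongr
    exact ht.2
  · refine ge_of_tendsto ((((continuous_measureReal_cylinder i).tendsto ν₀).comp hν₀).const_mul s) ?_
    filter_upwards [h, hpos] with t ht ht0
    have h1 := ((hν t).2 ht.1).log_add_mul_le (hN.twist i (t * s)) (i := i) (t := -(t * s))
      (R' := R) ht.1 (hρ t) (by rwa [twist_twist_neg]) (hν t).1
    refine le_of_mul_le_mul_left (a := t) ?_ ht0
    simp only [Function.comp_apply]
    linarith [ht.2]

lemma exists_isMax_of_growthRate_max {N N₁ N₂ : ℕ → (ℕ → Fin ℓ) → ℝ} (hN : IsCocycle N)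
    (hN₁ : IsCocycle N₁) (hN₂ : IsCocycle N₂) {i : Fin ℓ} {R : ℝ} (hR0 : 0 < R)
    (hR : IsGrowthRate N R) (s : ℝ)
    (hmax : ∀ t R₁ R₂, IsGrowthRate (twist i t N₁) R₁ → IsGrowthRate (twist i t N₂) R₂ →
      IsGrowthRate (twist i t N) (max R₁ R₂)) {μ : ProbabilityMeasure (ℕ → Fin ℓ)}
    (hμ : μ ∈ maxSet N R) :
    (IsGrowthRate N₁ R ∧ ∃ ν ∈ maxSet N₁ R, s * (μ : Measure (ℕ → Fin ℓ)).real (cylinder i) ≤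
      s * (ν : Measure (ℕ → Fin ℓ)).real (cylinder i)) ∨
    (IsGrowthRate N₂ R ∧ ∃ ν ∈ maxSet N₂ R, s * (μ : Measure (ℕ → Fin ℓ)).real (cylinder i) ≤
      s * (ν : Measure (ℕ → Fin ℓ)).real (cylinder i)) := by
  have : Nonempty (Fin ℓ) := ⟨i⟩
  have htw0 : ∀ N : ℕ → (ℕ → Fin ℓ) → ℝ, twist i (0 * s) N = N := fun N => by
    funext n x; simp [twist]
  choose ρ₁ hρ₁ using fun t => (hN₁.twist i (t * s)).exists_isGrowthRate
  choose ρ₂ hρ₂ using fun t => (hN₂.twist i (t * s)).exists_isGrowthRate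
  have hρ := fun t => hmax (t * s) _ _ (hρ₁ t) (hρ₂ t)
  have hR₀ : R = max (ρ₁ 0) (ρ₂ 0) := hR.unique (by simpa only [htw0] using hρ 0)
  have h₁0 : IsGrowthRate N₁ (ρ₁ 0) := by simpa only [htw0] using hρ₁ 0
  have h₂0 : IsGrowthRate N₂ (ρ₂ 0) := by simpa only [htw0] using hρ₂ 0
  have hlog := fun t => (hμ.2 hR0).log_add_mul_le hN hR0 hR (hρ t) hμ.1
  have hpos : ∀ t, 0 < max (ρ₁ t) (ρ₂ t) := fun t =>
    pos_of_mul_pos_right (hR0.trans_le (hR.le_twist hN (hρ t))) (Real.exp_pos _).le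
  set U := Ultrafilter.of (𝓝[>] (0 : ℝ)) with hUdef
  have hU : (U : Filter ℝ) ≤ 𝓝[>] 0 := Ultrafilter.of_le _
  -- Which block dominates may vary with `t`; the ultrafilter selects one of them for almost all
  -- small `t`.
  have hor : (∀ᶠ t in (U : Filter ℝ), ρ₂ t ≤ ρ₁ t) ∨ ∀ᶠ t in (U : Filter ℝ), ρ₁ t ≤ ρ₂ t :=
    Ultrafilter.eventually_or.1 (Eventually.of_forall fun t => le_total _ _)
  rcases hor with h | h
  · left
    refine exists_isMax_of_twist hN₁ hR0 h₁0 (hR₀ ▸ le_max_left _ _) hρ₁ U hU (h.mono fun t ht => ?_)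
    have h1 := hpos t
    have h2 := hlog t
    rw [max_eq_left ht] at h1 h2
    exact ⟨h1, h2⟩
  · right
    refine exists_isMax_of_twist hN₂ hR0 h₂0 (hR₀ ▸ le_max_right _ _) hρ₂ U hU (h.mono fun t ht => ?_)
    have h1 := hpos t
    have h2 := hlog t
    rw [max_eq_right ht] at h1 h2
    exact ⟨h1, h2⟩

/-- Realises the twist by scaling the operator of index `i`; scaling preserves invariant subspaces,
so the block formula for growth rates applies to twists too. -/
lemma norm_prodAlong_smul {V : Type*} [NormedAddCommGroup V] [NormedSpace ℂ V]
    (T : Fin ℓ → V →L[ℂ] V) (i : Fin ℓ) (t : ℝ) :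
    (fun n x => ‖prodAlong (fun k => ((Real.exp (if k = i then t else 0) : ℝ) : ℂ) • T k) x n‖) =
      twist i t fun n x => ‖prodAlong T x n‖ := by
  funext n x
  have : prodAlong (fun k => ((Real.exp (if k = i then t else 0) : ℝ) : ℂ) • T k) x n =
      ((Real.exp (t * symbolCount i n x) : ℝ) : ℂ) • prodAlong T x n := by
    induction n with
    | zero => simp [symbolCount]
    | succ n ih =>
      rw [prodAlong_succ, ih, prodAlong_succ, smul_mul_smul_comm, symbolCount_succ,
        ← Complex.ofReal_mul, ← Real.exp_add]
      congr 4
      split_ifs <;> ring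
  rw [this, norm_smul, Complex.norm_real, Real.norm_of_nonneg (Real.exp_pos _).le]
  rfl

/-- Any maximising measure can be replaced by one for which almost every point is strongly
extremal, without decreasing `s μ([i])`. -/
theorem exists_isMax_ae_strong {V : Type*} [NormedAddCommGroup V] [InnerProductSpace ℂ V]
    [FiniteDimensional ℂ V] {T : Fin ℓ → V →L[ℂ] V} {R : ℝ} (hR0 : 0 < R)
    (hR : IsGrowthRate (fun n x => ‖prodAlong T x n‖) R) (i : Fin ℓ) (s : ℝ)
    {μ : ProbabilityMeasure (ℕ → Fin ℓ)} (hμ : μ ∈ maxSet (fun n x => ‖prodAlong T x n‖) R) :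
    ∃ ν : ProbabilityMeasure (ℕ → Fin ℓ), MeasurePreserving shift (ν : Measure (ℕ → Fin ℓ)) ν ∧
      s * (μ : Measure (ℕ → Fin ℓ)).real (cylinder i) ≤
        s * (ν : Measure (ℕ → Fin ℓ)).real (cylinder i) ∧
      ∀ᵐ x ∂(ν : Measure (ℕ → Fin ℓ)), ∃ ε, 0 < ε ∧ ∀ n, 1 ≤ n →
        ε * R ^ n ≤ ‖prodAlong T x n‖ := by
  have : Nonempty (Fin ℓ) := ⟨i⟩
  induction hd : Module.finrank ℂ V using Nat.strong_induction_on generalizing V μ with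
  | _ d ih =>
    by_cases hb : ∃ C, ∀ n x, ‖prodAlong T x n‖ ≤ C * R ^ n
    · obtain ⟨C, hC⟩ := hb
      exact ⟨μ, hμ.1, le_rfl, (hμ.2 hR0).ae_exists_le (isCocycle_norm_prodAlong T) hR0
        (le_max_right C 1) fun n x => (hC n x).trans (by gcongr; exact le_max_left _ _)⟩
    obtain ⟨W, hbot, htop, hW⟩ := exists_invariant hR0 hR hb
    obtain ⟨B, C, ι, q, j, h⟩ := exists_isSplitting hW
    obtain ⟨hd1, hd2⟩ := finrank_lt_of_ne hbot htop
    rcases exists_isMax_of_growthRate_max (isCocycle_norm_prodAlong T)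
      (isCocycle_norm_prodAlong B) (isCocycle_norm_prodAlong C) (i := i) hR0 hR s
      (fun t R₁ R₂ h₁ h₂ => by
        rw [← norm_prodAlong_smul] at h₁ h₂ ⊢
        exact (h.smul _).isGrowthRate h₁ h₂) hμ with ⟨hR₁, ν, hν, hle⟩ | ⟨hR₂, ν, hν, hle⟩
    · obtain ⟨ν', hinv, hle', hae⟩ := ih _ (hd ▸ hd1) hR₁ hν rfl
      refine ⟨ν', hinv, hle.trans hle', hae.mono fun x hx => ?_⟩
      obtain ⟨ε, hε, hx⟩ := hx
      exact ⟨ε, hε, fun n hn => (hx n hn).trans (h.norm_left_le x n)⟩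
    · obtain ⟨ν', hinv, hle', hae⟩ := ih _ (hd ▸ hd2) hR₂ hν rfl
      refine ⟨ν', hinv, hle.trans hle', hae.mono fun x hx => ?_⟩
      obtain ⟨ε, hε, hx⟩ := hx
      exact ⟨ε, hε, fun n hn => (hx n hn).trans (h.norm_right_le x n)⟩

end Strong

/-! ### Optimal ratios of matrix families -/

section Matrices

variable {d ℓ : ℕ}

/-- The operators on Euclidean space given by a family of matrices. -/
def toOperators (A : Fin ℓ → Matrix (Fin d) (Fin d) ℂ) (k : Fin ℓ) :
    EuclideanSpace ℂ (Fin d) →L[ℂ] EuclideanSpace ℂ (Fin d) :=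
  Matrix.toEuclideanCLM (𝕜 := ℂ) (A k)

lemma prodAlong_toOperators (A : Fin ℓ → Matrix (Fin d) (Fin d) ℂ) (x : ℕ → Fin ℓ) (n : ℕ) :
    prodAlong (toOperators A) x n = Matrix.toEuclideanCLM (𝕜 := ℂ) (prodAlong A x n) :=
  (map_prodAlong (Matrix.toEuclideanCLM (𝕜 := ℂ)) A x n).symm

lemma norm_prodAlong_toOperators (A : Fin ℓ → Matrix (Fin d) (Fin d) ℂ) :
    (fun n x => ‖prodAlong (toOperators A) x n‖) = fun n x => ‖prodAlong A x n‖ := by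
  funext n x
  rw [prodAlong_toOperators, Matrix.l2_opNorm_toEuclideanCLM]

lemma StronglyExtremal.weaklyExtremal {A : Fin ℓ → Matrix (Fin d) (Fin d) ℂ} {x : ℕ → Fin ℓ}
    (h : StronglyExtremal A x) : WeaklyExtremal A x := by
  have : Nonempty (Fin ℓ) := ⟨x 0⟩
  obtain ⟨ε, hε, h⟩ := h
  have hN := isCocycle_norm_prodAlong A
  have hR := isGrowthRate_jointSpectralRadius A
  simp_rw [WeaklyExtremal, partialProd_eq_prodAlong] at h ⊢
  have hlow : Tendsto (fun n : ℕ => ε ^ (n : ℝ)⁻¹ * jointSpectralRadius A) atTop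
      (𝓝 (jointSpectralRadius A)) := by
    have := ((Real.continuousAt_const_rpow (a := ε) (b := 0) hε.ne').tendsto.comp
      (tendsto_inv_atTop_zero.comp (tendsto_natCast_atTop_atTop (R := ℝ)))).mul_const
      (jointSpectralRadius A)
    rw [Real.rpow_zero, one_mul] at this
    exact this
  refine tendsto_of_tendsto_of_tendsto_of_le_of_le' hlow (hR.tendsto hN) ?_ ?_
  · filter_upwards [eventually_ge_atTop 1] with n hn
    have h1 := h n hn
    calc _ = (ε * jointSpectralRadius A ^ n) ^ (n : ℝ)⁻¹ := by
          have := hR.nonneg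
          rw [Real.mul_rpow hε.le (by positivity), Real.pow_rpow_inv_natCast this (by omega)]
      _ ≤ _ := Real.rpow_le_rpow (by have := hR.nonneg; positivity) h1 (by positivity)
  · refine Eventually.of_forall fun n => ?_
    obtain ⟨K, -, hK⟩ := hN.exists_bound n
    exact le_ciSup (f := fun x => ‖prodAlong A x n‖ ^ (n : ℝ)⁻¹) ⟨K ^ (n : ℝ)⁻¹, by
      rintro _ ⟨y, rfl⟩
      exact Real.rpow_le_rpow (norm_nonneg _) (hK n le_rfl y) (by positivity)⟩ x

variable {A : Fin ℓ → Matrix (Fin d) (Fin d) ℂ} {i : Fin ℓ} {γ : ℝ}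

lemma exists_isMaximising [Nonempty (Fin ℓ)] (A : Fin ℓ → Matrix (Fin d) (Fin d) ℂ) :
    ∃ μ : ProbabilityMeasure (ℕ → Fin ℓ), IsMaximising A μ := by
  obtain ⟨μ, h1, h2⟩ := (isCocycle_norm_prodAlong A).exists_isMax
    (isGrowthRate_jointSpectralRadius A)
  exact ⟨μ, (isMaximising_iff A μ).2 ⟨inferInstance, h1, h2⟩⟩

lemma measureReal_eq_of_strongly
    (h : ∀ x, StronglyExtremal A x → HasFrequency i x γ) {μ : Measure (ℕ → Fin ℓ)}
    (hμ : IsMaximising A μ) : μ.real (cylinder i) = γ := by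
  have : Nonempty (Fin ℓ) := ⟨i⟩
  obtain ⟨hprob, hinv, hmax⟩ := (isMaximising_iff A μ).1 hμ
  have hR := isGrowthRate_jointSpectralRadius A
  rcases hR.nonneg.eq_or_lt with h0 | h0
  · refine measureReal_cylinder_eq_of_ae_hasFrequency hinv (Eventually.of_forall fun x => h x ?_)
    refine ⟨1, one_pos, fun n hn => ?_⟩
    rw [← h0, zero_pow (by omega), mul_zero]
    exact norm_nonneg _
  -- The replacement measure depends on `s`; the signs `s = 1` and `s = -1` give the two
  -- inequalities.
  · have key : ∀ s : ℝ, s * μ.real (cylinder i) ≤ s * γ := by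
      intro s
      rw [← norm_prodAlong_toOperators] at hR hmax
      obtain ⟨ν, hν, hle, hae⟩ := exists_isMax_ae_strong h0 hR i s
        (μ := ⟨μ, hprob⟩) ⟨hinv, hmax⟩
      have hνγ : (ν : Measure (ℕ → Fin ℓ)).real (cylinder i) = γ := by
        refine measureReal_cylinder_eq_of_ae_hasFrequency hν (hae.mono fun x hx => h x ?_)
        obtain ⟨ε, hε, hx⟩ := hx
        refine ⟨ε, hε, fun n hn => ?_⟩
        rw [partialProd_eq_prodAlong, ← Matrix.l2_opNorm_toEuclideanCLM, ← prodAlong_toOperators]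
        exact hx n hn
      rwa [hνγ] at hle
    have h1 := key 1
    have h2 := key (-1)
    linarith

lemma measureReal_eq_of_ergodic
    (h : ∀ μ : Measure (ℕ → Fin ℓ), IsMaximising A μ → Ergodic shift μ →
      μ.real (cylinder i) = γ) {μ : Measure (ℕ → Fin ℓ)}
    (hμ : IsMaximising A μ) : μ.real (cylinder i) = γ := by
  have : Nonempty (Fin ℓ) := ⟨i⟩
  obtain ⟨hprob, hinv, hmax⟩ := (isMaximising_iff A μ).1 hμ
  have key : ∀ s : ℝ, s * μ.real (cylinder i) ≤ s * γ := by
    intro s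
    have hint : ∀ ν : Measure (ℕ → Fin ℓ), ∫ x, s * (cylinder i).indicator (fun _ => (1 : ℝ)) x ∂ν =
        s * ν.real (cylinder i) := fun ν => by
      rw [integral_const_mul, integral_indicator_const (1 : ℝ) (isClopen_cylinder i).2.measurableSet,
        smul_eq_mul, mul_one]
    obtain ⟨ν, hν, herg, hle⟩ := exists_ergodic_isMax (isCocycle_norm_prodAlong A)
      (isGrowthRate_jointSpectralRadius A)
      (g := ⟨_, (continuous_indicator_cylinder i).const_mul s⟩)
    have h1 := hle ⟨μ, hprob⟩ ⟨hinv, hmax⟩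
    simp only [ContinuousMap.coe_mk, hint, ProbabilityMeasure.coe_mk] at h1
    rwa [h ν ((isMaximising_iff A ν).2 ⟨inferInstance, hν⟩) herg] at h1
  have h1 := key 1
  have h2 := key (-1)
  linarith

lemma measureReal_eq_of_kozyakin (hd : 1 ≤ d) {p : Seminorm ℂ (Fin d → ℂ)}
    (hp : IsBarabanovNorm A p)
    (h : ∀ x, KozyakinExtremal A x → HasFrequency i x γ) {μ : Measure (ℕ → Fin ℓ)}
    (hμ : IsMaximising A μ) : μ.real (cylinder i) = γ := by
  have : Nonempty (Fin ℓ) := ⟨i⟩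
  have : Nonempty (Fin d) := ⟨⟨0, hd⟩⟩
  obtain ⟨hprob, hinv, hmax⟩ := (isMaximising_iff A μ).1 hμ
  have hR := isGrowthRate_jointSpectralRadius A
  have hle : ∀ k v, p (A k *ᵥ v) ≤ jointSpectralRadius A * p v := fun k v =>
    (hp.2 v).2 ⟨k, rfl⟩
  refine measureReal_cylinder_eq_of_ae_hasFrequency hinv ?_
  rcases hR.nonneg.eq_or_lt with h0 | h0
  -- At zero spectral radius the Barabanov norm forces every matrix to annihilate every vector, so
  -- all sequences are Kozyakin extremal; `d ≥ 1` supplies a unit vector.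
  · refine Eventually.of_forall fun x => h x ?_
    obtain ⟨w, hw⟩ := exists_ne (0 : Fin d → ℂ)
    have hpw : 0 < p w := (apply_nonneg p w).lt_of_ne fun h1 => hw (hp.1 w h1.symm)
    refine ⟨p, hp, (((p w)⁻¹ : ℝ) : ℂ) • w, ?_, fun n hn => ?_⟩
    · rw [map_smul_eq_mul, Complex.norm_real, norm_inv, Real.norm_of_nonneg hpw.le,
        inv_mul_cancel₀ hpw.ne']
    · obtain ⟨n, rfl⟩ : ∃ m, n = m + 1 := ⟨n - 1, by omega⟩
      rw [← h0, zero_pow (by omega), partialProd, ← Matrix.mulVec_mulVec]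
      refine le_antisymm ((hle _ _).trans_eq ?_) (apply_nonneg _ _)
      rw [← h0, zero_mul]
  · rw [← norm_prodAlong_toOperators] at hmax
    let p' : Seminorm ℂ (EuclideanSpace ℂ (Fin d)) :=
      p.comp (WithLp.linearEquiv 2 ℂ (Fin d → ℂ)).toLinearMap
    have hp' : ∀ v, p' v = p (WithLp.ofLp v) := fun v => rfl
    have hae := (hmax h0).ae_exists_seminorm_eq (p := p')
      (fun v hv => (WithLp.ofLp_eq_zero 2).1 (hp.1 _ hv)) h0
      (fun k v => by
        rw [hp', hp', toOperators, Matrix.ofLp_toEuclideanCLM]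
        exact hle k _) hinv
    filter_upwards [hae] with x hx
    obtain ⟨v, hv, hx⟩ := hx
    refine h x ⟨p, hp, WithLp.ofLp v, hv, fun n _ => ?_⟩
    rw [partialProd_eq_prodAlong, ← Matrix.ofLp_toEuclideanCLM, ← prodAlong_toOperators]
    exact hx n

/-- An optimal ratio is the measure of the cylinder under every maximising measure. -/
theorem IsOptimalRatio.measureReal_eq (hd : 1 ≤ d) (h : IsOptimalRatio A i γ)
    {μ : Measure (ℕ → Fin ℓ)} (hμ : IsMaximising A μ) : μ.real (cylinder i) = γ := by
  obtain ⟨-, h | h | h | h | ⟨⟨p, hp⟩, h⟩⟩ := h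
  · exact measureReal_eq_of_strongly (fun x hx => h x hx.weaklyExtremal) hμ
  · exact measureReal_eq_of_strongly h hμ
  · exact measureReal_eq_of_ergodic h hμ
  · exact h μ hμ
  · exact measureReal_eq_of_kozyakin hd hp h hμ

/-- Limits of maximising measures are maximising. -/
theorem isMaximising_of_tendsto [Nonempty (Fin ℓ)] {Δ : Type*} [TopologicalSpace Δ]
    {A : Fin ℓ → Δ → Matrix (Fin d) (Fin d) ℂ} (hA : ∀ k, Continuous (A k)) {a₀ : Δ}
    {F : Filter Δ} [F.NeBot] (hF : F ≤ 𝓝 a₀) {μs : Δ → ProbabilityMeasure (ℕ → Fin ℓ)}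
    (hμs : ∀ a, IsMaximising (fun k => A k a) (μs a)) {μ : ProbabilityMeasure (ℕ → Fin ℓ)}
    (hμ : Tendsto μs F (𝓝 μ)) : IsMaximising (fun k => A k a₀) μ := by
  have hmax := fun a => (isMaximising_iff _ _).1 (hμs a)
  refine (isMaximising_iff _ _).2 ⟨inferInstance, measurePreserving_of_tendsto' continuous_shift hμ
    (Eventually.of_forall fun a => (hmax a).2.1), fun h0 n hn δ hδ => ?_⟩
  have hT : ∀ k, Continuous fun a => toOperators (fun k => A k a) k := fun k =>
    (AddMonoidHomClass.continuous_of_bound (Matrix.toEuclideanCLM (n := Fin d) (𝕜 := ℂ)) 1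
      fun M => by rw [Matrix.l2_opNorm_toEuclideanCLM, one_mul]).comp (hA k)
  -- Only lower semicontinuity of the joint spectral radius is used: nearby radii are at least any
  -- `s` below the limiting one, and `s` then increases to it.
  have key : ∀ s ∈ Set.Ioo 0 (jointSpectralRadius fun k => A k a₀),
      n * Real.log s ≤ ∫ x, Real.log (max ‖prodAlong (fun k => A k a₀) x n‖ δ)
        ∂(μ : Measure (ℕ → Fin ℓ)) := by
    intro s hs
    have hev := eventually_le_growthRate (T := fun k a => toOperators (fun k => A k a) k) hT
      (R := fun a => jointSpectralRadius fun k => A k a)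
      (fun a => by
        have := isGrowthRate_jointSpectralRadius fun k => A k a
        rwa [← norm_prodAlong_toOperators] at this) a₀ hs.1.le hs.2
    obtain ⟨G, hG⟩ := continuous_curry_log_max
      (F := fun a x => ‖prodAlong (fun k => A k a) x n‖) (continuous_prodAlong hA n).norm hδ
    have h1 := tendsto_integral_of_tendsto hμ ((G.continuous.tendsto a₀).mono_left hF)
    simp only [hG] at h1
    refine ge_of_tendsto h1 ((hev.filter_mono hF).mono fun a ha => ?_)
    refine le_trans ?_ ((hmax a).2.2 (hs.1.trans_le ha) n hn δ hδ)
    gcongr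
    exact hs.1
  have hlim : Tendsto (fun s => n * Real.log s) (𝓝[<] (jointSpectralRadius fun k => A k a₀))
      (𝓝 (n * Real.log (jointSpectralRadius fun k => A k a₀))) :=
    ((Real.continuousAt_log h0.ne').tendsto.mono_left nhdsWithin_le_nhds).const_mul _
  exact le_of_tendsto hlim (Filter.mem_of_superset (Ioo_mem_nhdsLT h0) key)

end Matrices

end

end OptimalRatio

/-! ### Uniqueness and continuity of the optimal ratio -/

theorem mainTheorem7 {Δ : Type*} [MetricSpace Δ] {d ℓ : ℕ} (hd : 1 ≤ d)
    (A : Fin ℓ → Δ → Matrix (Fin d) (Fin d) ℂ) (hA : ∀ k, Continuous (A k)) (i : Fin ℓ)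
    (hratio : ∀ lam : Δ, OptimalRatio.HasUniqueOptimalRatio (fun k => A k lam) i) :
    ∃ r : Δ → Set.Icc (0 : ℝ) 1,
      (∀ (lam : Δ) (γ : ℝ), OptimalRatio.IsOptimalRatio (fun k => A k lam) i γ ↔ γ = r lam) ∧
        Continuous r := by
  have : Nonempty (Fin ℓ) := ⟨i⟩
  choose γ hγ using hratio
  choose μs hμs using fun lam => OptimalRatio.exists_isMaximising fun k => A k lam
  refine ⟨fun lam => ⟨γ lam, (hγ lam).1⟩, fun lam γ' => ⟨fun h => ?_, fun h => h ▸ hγ lam⟩, ?_⟩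
  · exact (h.measureReal_eq hd (hμs lam)).symm.trans ((hγ lam).measureReal_eq hd (hμs lam))
  -- Along each ultrafilter tending to `lam` the chosen maximising measures converge. Their limit is
  -- maximising at `lam`, so its cylinder has measure `γ lam` whichever ultrafilter was taken.
  · refine Continuous.subtype_mk (continuous_iff_continuousAt.2 fun lam =>
      (tendsto_iff_ultrafilter _ _ _).2 fun U hU => ?_) _
    obtain ⟨μ, hμ⟩ := OptimalRatio.exists_tendsto_of_ultrafilter U μs
    have hmax := OptimalRatio.isMaximising_of_tendsto hA hU hμs hμ
    have h1 := ((OptimalRatio.continuous_measureReal_cylinder i).tendsto μ).comp hμ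
    rw [(hγ lam).measureReal_eq hd hmax] at h1
    refine h1.congr fun a => ?_
    exact (hγ a).measureReal_eq hd (hμs a)
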